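/- Let $K$ be a field, $c\ge 1$ and $i\ge 0$ integers, and let $\mathbb{N}$ denote the positive integers. For $n\ge 1$ let $R_n=K[x_{k,j}\mid 1\le k\le c,\ 1\le j\le n]$ with the standard grading. Let $\mathrm{Inc}(\mathbb{N})^i$ be the set of strictly increasing maps $\pi:\mathbb{N}\to\mathbb{N}$ with $\pi(j)=j$ for all $j\le i$; such a $\pi$ acts by $x_{k,j}\mapsto x_{k,\pi(j)}$. Let $\mathcal{I}=(I_n)_{n\ge 1}$ be a nonzero $\mathrm{Inc}(\mathbb{N})^i$-invariant chain of monomial ideals, that is: each $I_n\subseteq R_n$ is a monomial ideal, some $I_n$ is nonzero, and $\pi(I_m)\subseteq I_n$ whenever $m\le n$, $\pi\in\mathrm{Inc}(\mathbb{N})^i$ and $\pi(m)\le n$. For a monomial $u\ne 1$ let $\min(u)$ be the smallest $j$ such that some $x_{k,j}$ divides $u$, and put $\min(1)=0$. For an integer $s\ge 0$ let $w_k^{(s)}(u)$ be the largest exponent in $u$ of a variable $x_{k,j}$ with $j>s$ ($0$ if there is no such variable), and let $w^{(s)}(u)=\max_k w_k^{(s)}(u)$. For a nonzero monomial ideal $J\subseteq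 R_n$ with minimal set of monomial generators $G(J)$, let $G^{(s)}_+(J)=\{u\in G(J)\mid \min(u)>s\}$ and set \[ w_k^{(s)}(J)=\max_{u\in G(J)} w_k^{(s)}(u),\qquad \omega^{(s)}(J)=\begin{cases}\min\{w^{(s)}(u)\mid u\in G^{(s)}_+(J)\}&\text{if } G^{(s)}_+(J)\neq\emptyset,\\ \max\{w^{(s)}(u)\mid u\in G(J)\}&\text{otherwise.}\end{cases} \] Then there are (unique) integers $w_1(\mathcal{I}),\dots,w_c(\mathcal{I})$ and $\omega(\mathcal{I})$ such that for all $s\gg 0$ one has $w_k^{(s)}(I_n)=w_k(\mathcal{I})$ for all $k$ and $\omega^{(s)}(I_n)=\omega(\mathcal{I})$ for all $n\gg 0$ (depending on $s$). Set \[ C(\mathcal{I})=\max\{\omega(\mathcal{I})-1,0\}+\max_{1\le l\le c}\ \sum_{k\ne l} w_k(\mathcal{I}). \] Then there is a constant $D$ (depending on $\mathcal{I}$) such that \[ \operatorname{reg}(I_n)\le C(\mathcal{I})\,n+D\qquad\text{for all } n\gg 0, \] where $\operatorname{reg}(I_n)=\max\{j-p\mid \operatorname{Tor}^{R_n}_p(K,I_n)_j\ne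 0\}$ is the Castelnuovo-Mumford regularity. -/

import Mathlib

open Filter

noncomputable section

namespace IncChain

/-! ### Graded Tor and Castelnuovo-Mumford regularity of a homogeneous ideal -/

section Regularity

variable {K : Type*} [Field K] {σ : Type*}

/-- A graded free resolution `⋯ → F₂ → F₁ → F₀ → I → 0` of an ideal `I` of the standard graded
polynomial ring `S = K[σ]`. The module `F p` is free on `B p`, the basis vector `b : B p` lies in
degree `deg p b` (so `F p` is the direct sum of the `S(-deg p b)`), and all maps are homogeneous of
degree `0`. -/
structure GradedFreeResolution (I : Ideal (MvPolynomial σ K)) where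
  B : ℕ → Type
  deg : ∀ p, B p → ℤ
  d : ∀ p, (B (p + 1) →₀ MvPolynomial σ K) →ₗ[MvPolynomial σ K] (B p →₀ MvPolynomial σ K)
  aug : (B 0 →₀ MvPolynomial σ K) →ₗ[MvPolynomial σ K] MvPolynomial σ K
  homogeneous_d : ∀ p (b : B (p + 1)) (b' : B p) (m : σ →₀ ℕ),
    (d p (Finsupp.single b 1) b').coeff m ≠ 0 → deg (p + 1) b = deg p b' + (m.degree : ℤ)
  homogeneous_aug : ∀ (b : B 0) (m : σ →₀ ℕ),
    (aug (Finsupp.single b 1)).coeff m ≠ 0 → deg 0 b = (m.degree : ℤ)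
  range_aug : LinearMap.range aug = I
  exact_aug : Function.Exact (d 0) aug
  exact_d : ∀ p, Function.Exact (d (p + 1)) (d p)

namespace GradedFreeResolution

variable {I : Ideal (MvPolynomial σ K)} (F : GradedFreeResolution I)

/-- The differential of `K ⊗ F`, where `K` is the residue field of `S` at the ideal of the
variables: `K ⊗ F p` is the `K`-vector space on `B p`, and the entries of the matrix of `F.d p` are
replaced by their constant coefficients. -/
def dBar (p : ℕ) : (F.B (p + 1) →₀ K) →ₗ[K] (F.B p →₀ K) :=
  Finsupp.linearCombination K fun b =>
    (F.d p (Finsupp.single b 1)).mapRange MvPolynomial.constantCoeff (map_zero _)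

/-- The degree `j` part of `K ⊗ F p`. -/
def degreePart (p : ℕ) (j : ℤ) : Submodule K (F.B p →₀ K) :=
  Finsupp.supported K K {b | F.deg p b = j}

/-- The `p`-cycles of degree `j` of `K ⊗ F`. -/
def cycles : ∀ p : ℕ, ℤ → Submodule K (F.B p →₀ K)
  | 0, j => F.degreePart 0 j
  | p + 1, j => F.degreePart (p + 1) j ⊓ LinearMap.ker (F.dBar p)

/-- The `p`-boundaries of degree `j` of `K ⊗ F`. -/
def boundaries (p : ℕ) (j : ℤ) : Submodule K (F.B p →₀ K) :=
  (F.degreePart (p + 1) j).map (F.dBar p)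

end GradedFreeResolution

/-- `Tor_p^S(K, I)_j ≠ 0`: the vector space `Tor_p^S(K, I)_j = H_p(K ⊗ F)_j` is the quotient of the
cycles by the boundaries, so it is nonzero when some cycle is not a boundary. (Up to isomorphism,
this quotient does not depend on the graded free resolution `F`.) -/
def TorNonzero (I : Ideal (MvPolynomial σ K)) (p : ℕ) (j : ℤ) : Prop :=
  ∃ F : GradedFreeResolution I, ∃ z ∈ F.cycles p j, z ∉ F.boundaries p j

/-- The Castelnuovo-Mumford regularity `reg I = max {j - p | Tor_p^S(K, I)_j ≠ 0}`, as a supremum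
of extended reals: it is `⊤` if the set is unbounded above and `⊥` if it is empty. -/
def reg (I : Ideal (MvPolynomial σ K)) : EReal :=
  ⨆ (p : ℕ) (j : ℤ) (_ : TorNonzero I p j), (((j - p : ℤ) : ℝ) : EReal)

/-- An ideal generated by monomials. -/
def IsMonomialIdeal (I : Ideal (MvPolynomial σ K)) : Prop :=
  ∃ s : Set (σ →₀ ℕ), I = Ideal.span ((fun u => MvPolynomial.monomial u (1 : K)) '' s)

/-- The (exponent vectors of the) minimal monomial generators of a monomial ideal: the monomials
of `I` that are minimal with respect to divisibility. -/
def minGens (I : Ideal (MvPolynomial σ K)) : Set (σ →₀ ℕ) :=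
  {u | Minimal (fun v => MvPolynomial.monomial v (1 : K) ∈ I) u}

end Regularity

/-! ### The rings `R_n`, the monoids `Inc(ℕ)^i` and invariant chains

Column indices are counted from `0`: the variable `x_{k,j}` with `1 ≤ k ≤ c` and `1 ≤ j ≤ n` is
`X (k - 1, j - 1)`. Monomials are represented by their exponent vectors. -/

/-- The polynomial ring `R_n = K[x_{k,j} | k ∈ [c], j ∈ [n]]`. -/
abbrev R (K : Type*) [Field K] (c n : ℕ) : Type _ := MvPolynomial (Fin c × Fin n) K

/-- `Inc(ℕ)^i`: the strictly increasing maps that fix the first `i` elements. -/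
def Inc (i : ℕ) : Set (ℕ → ℕ) := {π | StrictMono π ∧ ∀ j < i, π j = j}

section Chain

variable {K : Type*} [Field K] {c : ℕ}

/-- The action `x_{k,j} ↦ x_{k,π(j)}` of a map `π` on `R_m`, with values in `R_n`, for `π` that maps
the first `m` elements into the first `n` elements. -/
def act {m n : ℕ} (π : ℕ → ℕ) (h : ∀ j < m, π j < n) : R K c m →ₐ[K] R K c n :=
  MvPolynomial.rename fun v => (v.1, ⟨π v.2, h v.2 v.2.isLt⟩)

/-- `(I_n)_{n ≥ 1}` is an `Inc(ℕ)^i`-invariant chain of ideals. (The term `I 0` plays no role.) -/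
def IsInvariantChain (i : ℕ) (I : ∀ n, Ideal (R K c n)) : Prop :=
  ∀ m n, 1 ≤ m → m ≤ n → ∀ π ∈ Inc i, ∀ h : ∀ j < m, π j < n, ∀ f ∈ I m, act π h f ∈ I n

/-! ### Weights -/

/-- `min(u)`: the smallest column index (counted from `1`) of a variable that divides `u`, with
`min(1) = 0` (the infimum of the empty set of natural numbers is `0`). -/
def minIndex {n : ℕ} (u : Fin c × Fin n →₀ ℕ) : ℕ :=
  sInf {j | ∃ v ∈ u.support, j = (v.2 : ℕ) + 1}

/-- `w_k^{(i)}(u)`: the largest exponent in `u` of a variable `x_{k,j}` with `j > i`. -/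
def monWeightRow {n : ℕ} (i : ℕ) (k : Fin c) (u : Fin c × Fin n →₀ ℕ) : ℕ :=
  (Finset.univ.filter fun j : Fin n => i < (j : ℕ) + 1).sup fun j => u (k, j)

/-- `w^{(i)}(u) = max_k w_k^{(i)}(u)`. -/
def monWeight {n : ℕ} (i : ℕ) (u : Fin c × Fin n →₀ ℕ) : ℕ :=
  Finset.univ.sup fun k => monWeightRow i k u

/-- `G_+^{(i)}(I)`: the minimal generators `u` with `min(u) > i`. -/
def minGensPlus {n : ℕ} (i : ℕ) (I : Ideal (R K c n)) : Set (Fin c × Fin n →₀ ℕ) :=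
  {u ∈ minGens I | i < minIndex u}

/-- `w_k^{(i)}(I)`. -/
def weightRow {n : ℕ} (i : ℕ) (k : Fin c) (I : Ideal (R K c n)) : ℕ :=
  sSup (monWeightRow i k '' minGens I)

open Classical in
/-- `ω^{(i)}(I)`. -/
def omega {n : ℕ} (i : ℕ) (I : Ideal (R K c n)) : ℕ :=
  if (minGensPlus i I).Nonempty then sInf (monWeight i '' minGensPlus i I)
  else sSup (monWeight i '' minGens I)

open Classical in
/-- The eventual value of an eventually constant sequence (and `0` for other sequences). -/
def eventualValue (f : ℕ → ℕ) : ℕ :=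
  if h : ∃ a, ∀ᶠ n in atTop, f n = a then h.choose else 0

/-- `w_k(𝓘)`: the value for `i ≫ 0` of `w_k^{(i)}(𝓘)`, which is the value of `w_k^{(i)}(I_n)`
for `n ≫ 0`. -/
def chainWeightRow (k : Fin c) (I : ∀ n, Ideal (R K c n)) : ℕ :=
  eventualValue fun i => eventualValue fun n => weightRow i k (I n)

/-- `ω(𝓘)`: the value for `i ≫ 0` of `ω^{(i)}(𝓘)`, which is the value of `ω^{(i)}(I_n)`
for `n ≫ 0`. -/
def chainOmega (I : ∀ n, Ideal (R K c n)) : ℕ :=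
  eventualValue fun i => eventualValue fun n => omega i (I n)

/-- `C(𝓘) = max {ω(𝓘) - 1, 0} + max_l ∑_{k ≠ l} w_k(𝓘)`. -/
def boundCoeff (I : ∀ n, Ideal (R K c n)) : ℤ :=
  max ((chainOmega I : ℤ) - 1) 0 +
    ((Finset.univ.sup fun l : Fin c => ∑ k ∈ Finset.univ.erase l, chainWeightRow k I : ℕ) : ℤ)

end Chain

end IncChain

end

/-!
Tensoring a graded free resolution with the Koszul complex identifies the vanishing of `Tor_p` in
degree `j` with the exactness of a strand of the Koszul complex with coefficients in the ideal. A
Koszul cycle splits into multihomogeneous parts, and its part in the multidegree `a` is a boundary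
as soon as the upper Koszul simplicial complex of the ideal in the multidegree `a` has a cone point.
So it suffices to find cone points in all multidegrees of large total degree.

By Higman's lemma, finitely many monomials, with at most `r` columns and exponents at most `B`,
generate the chain up to the action of `Inc(ℕ)^i`. Since a minimal generator of `I_{n+1}` therefore
leaves a column unused when `n` is large, it comes from a minimal generator of `I_n`, and this makes
the weights stabilize.

Let the total degree of `a` exceed the bound. If some exponent of `a` is larger than in all minimal
generators, then its variable is a cone point. Otherwise the exponents beyond column `s` are bounded
by the weights `w_k`, so a column of degree larger than `C(𝓘)` has all its exponents at least `ω`,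
and there are at least `r` such columns. A monomial of the ideal is divisible, as far as the first
`s` columns are concerned, by a generator of weight at most `ω`, and the columns of this generator
beyond `s` can be moved to such large columns. So membership in the ideal does not depend on the
remaining columns, and every variable beyond column `s` is a cone point.
-/

noncomputable section

namespace IncChain

/-! ### Koszul complexes -/

section Koszul

variable {σ : Type*} [LinearOrder σ]

/-- The sign with which the basis vector of `v` is moved to its place in the wedge product of the
basis vectors of `τ`. -/
def koszulSign (v : σ) (τ : Finset σ) : ℤ :=
  ∏ u ∈ τ, if u < v then -1 else 1

theorem koszulSign_mul_self (v : σ) (τ : Finset σ) : koszulSign v τ * koszulSign v τ = 1 := by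
  rw [koszulSign, ← Finset.prod_mul_distrib]
  refine Finset.prod_eq_one fun u _ => ?_
  split_ifs <;> norm_num

theorem koszulSign_insert {u v : σ} {τ : Finset σ} (hu : u ∉ τ) :
    koszulSign v (insert u τ) = (if u < v then -1 else 1) * koszulSign v τ :=
  Finset.prod_insert hu

theorem koszulSign_mul_insert {u v : σ} {τ : Finset σ} (huv : u ≠ v) (hu : u ∉ τ) (hv : v ∉ τ) :
    koszulSign u τ * koszulSign v (insert u τ) = -(koszulSign v τ * koszulSign u (insert v τ)) := by
  rw [koszulSign_insert hu, koszulSign_insert hv]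
  rcases huv.lt_or_gt with h | h <;> simp [h, h.not_gt, mul_comm]

theorem koszulSign_insert_mul_insert {u v : σ} {τ : Finset σ} (huv : u ≠ v) (hu : u ∉ τ)
    (hv : v ∉ τ) :
    koszulSign u (insert v τ) * koszulSign v (insert u τ) =
      -(koszulSign v τ * koszulSign u τ) := by
  rw [koszulSign_insert hu, koszulSign_insert hv]
  rcases huv.lt_or_gt with h | h <;> simp [h, h.not_gt, mul_comm]

variable {M : Type*} [AddCommGroup M]

/-- The exterior multiplication of Koszul chains by the basis vector of `v`. -/
def koszulCone (v : σ) (f : Finset σ → M) : Finset σ → M :=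
  fun τ => if v ∈ τ then koszulSign v (τ.erase v) • f (τ.erase v) else 0

theorem koszulCone_zero (v : σ) : koszulCone v (0 : Finset σ → M) = 0 := by
  funext τ
  simp [koszulCone]

variable [Fintype σ] {A N : Type*} [CommRing A] [Module A M] [AddCommGroup N] [Module A N]
  (x : σ → A)

/-- The differential of the Koszul complex of `x` with coefficients in a module `M`. A chain is
encoded as the function that assigns to `τ` the coefficient of the wedge product of the basis
vectors of `τ`, and all homological degrees are put together. -/
def koszul : (Finset σ → M) →+ (Finset σ → M) where
  toFun f τ := ∑ v ∈ τᶜ, koszulSign v τ • x v • f (insert v τ)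
  map_zero' := by
    funext τ
    simp
  map_add' f g := by
    funext τ
    simp [smul_add, Finset.sum_add_distrib]

theorem koszul_apply (f : Finset σ → M) (τ : Finset σ) :
    koszul x f τ = ∑ v ∈ τᶜ, koszulSign v τ • x v • f (insert v τ) := rfl

theorem koszul_comp (φ : M →ₗ[A] N) (f : Finset σ → M) :
    koszul x (φ ∘ f) = φ ∘ koszul x f := by
  funext τ
  simp [koszul_apply, map_sum]

theorem koszul_smul (r : A) (f : Finset σ → M) : koszul x (r • f) = r • koszul x f :=
  koszul_comp x (LinearMap.lsmul A M r) f

theorem koszul_koszul (f : Finset σ → M) : koszul x (koszul x f) = 0 := by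
  funext τ
  simp only [koszul_apply, Pi.zero_apply, Finset.smul_sum]
  rw [Finset.sum_sigma']
  have hmem : ∀ p : (_ : σ) × σ, p ∈ τᶜ.sigma (fun u => (insert u τ)ᶜ) ↔
      p.1 ∉ τ ∧ p.2 ≠ p.1 ∧ p.2 ∉ τ := by
    simp
  refine Finset.sum_involution (fun p _ => ⟨p.2, p.1⟩) ?_ ?_ ?_ fun _ _ => rfl
  · rintro ⟨u, v⟩ h
    obtain ⟨hu : u ∉ τ, huv : v ≠ u, hv : v ∉ τ⟩ := (hmem _).1 h
    have hcomm (s t : ℤ) (a b : A) (y : M) : s • a • t • b • y = (s * t) • (a * b) • y := by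
      rw [smul_comm a t, smul_smul, smul_smul]
    rw [Finset.insert_comm v u, hcomm, hcomm, mul_comm (x v), koszulSign_mul_insert huv.symm hu hv,
      ← add_smul, neg_add_cancel, zero_smul]
  · rintro ⟨u, v⟩ h _ heq
    exact ((hmem _).1 h).2.1 (congrArg Sigma.fst heq)
  · rintro ⟨u, v⟩ h
    obtain ⟨hu, huv, hv⟩ := (hmem _).1 h
    exact (hmem _).2 ⟨hv, huv.symm, hu⟩

/-- Hence a cycle that is divisible by `x v` is a boundary. -/
theorem koszul_koszulCone_add (v : σ) (f : Finset σ → M) :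
    koszul x (koszulCone v f) + koszulCone v (koszul x f) = x v • f := by
  funext τ
  simp only [Pi.add_apply, Pi.smul_apply, koszul_apply, koszulCone]
  by_cases hv : v ∈ τ
  · obtain ⟨ρ, hρ, rfl⟩ : ∃ ρ, v ∉ ρ ∧ insert v ρ = τ :=
      ⟨τ.erase v, Finset.notMem_erase _ _, Finset.insert_erase hv⟩
    have hcompl : ρᶜ = insert v (insert v ρ)ᶜ := by
      rw [Finset.compl_insert, Finset.insert_erase (by simpa using hρ)]
    rw [if_pos hv, Finset.erase_insert hρ, hcompl, Finset.sum_insert (by simp), smul_add,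
      smul_smul, koszulSign_mul_self, one_smul, add_left_comm, Finset.smul_sum,
      ← Finset.sum_add_distrib]
    refine add_eq_left.2 (Finset.sum_eq_zero fun u hu => ?_)
    obtain ⟨huv, hu⟩ : u ≠ v ∧ u ∉ ρ := by simpa using hu
    rw [if_pos (Finset.mem_insert_of_mem hv), Finset.insert_comm,
      Finset.erase_insert (by simp [hρ, huv.symm]), smul_comm (x u), smul_smul, smul_smul,
      koszulSign_insert_mul_insert huv hu hρ, ← add_smul, neg_add_cancel, zero_smul]
  · rw [if_neg hv, add_zero, Finset.sum_eq_single_of_mem v (by simpa using hv)]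
    · rw [if_pos (Finset.mem_insert_self v τ), Finset.erase_insert hv, smul_comm (x v), smul_smul,
        koszulSign_mul_self, one_smul]
    · intro u _ huv
      rw [if_neg (by simp [hv, huv.symm]), smul_zero, smul_zero]

end Koszul

/-! ### Koszul complexes of polynomial rings -/

section Multigrading

variable {σ A B : Type*} [CommRing A]

open Classical in
/-- The sum of the terms of a polynomial whose exponent vectors satisfy `P`. -/
def filterPolynomial (P : (σ →₀ ℕ) → Prop) (p : MvPolynomial σ A) : MvPolynomial σ A :=
  ∑ m ∈ p.support with P m, MvPolynomial.monomial m (p.coeff m)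

open Classical in
theorem coeff_filterPolynomial (P : (σ →₀ ℕ) → Prop) (p : MvPolynomial σ A) (m : σ →₀ ℕ) :
    (filterPolynomial P p).coeff m = if P m then p.coeff m else 0 := by
  simp only [filterPolynomial, MvPolynomial.coeff_sum, MvPolynomial.coeff_monomial,
    Finset.sum_ite_eq', Finset.mem_filter, MvPolynomial.mem_support_iff]
  grind

/-- The part of an element of a free module over a polynomial ring that consists of the terms whose
positions and exponent vectors satisfy `P`. -/
def filterTerms (P : B → (σ →₀ ℕ) → Prop) :
    (B →₀ MvPolynomial σ A) →+ (B →₀ MvPolynomial σ A) where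
  toFun x := Finsupp.onFinset x.support (fun b => filterPolynomial (P b) (x b)) fun b hb => by
    contrapose! hb
    simp [filterPolynomial, Finsupp.notMem_support_iff.1 hb]
  map_zero' := by
    ext
    simp [filterPolynomial]
  map_add' x y := by
    classical
    ext b m
    simp [coeff_filterPolynomial, ite_add_zero]

open Classical in
theorem coeff_filterTerms (P : B → (σ →₀ ℕ) → Prop) (x : B →₀ MvPolynomial σ A) (b : B)
    (m : σ →₀ ℕ) :
    (filterTerms P x b).coeff m = if P b m then (x b).coeff m else 0 :=
  coeff_filterPolynomial (P b) (x b) m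

/-- The exponent vector of the squarefree monomial with support `τ`. -/
def squarefreeExponent (τ : Finset σ) : σ →₀ ℕ := ∑ v ∈ τ, Finsupp.single v 1

theorem degree_squarefreeExponent (τ : Finset σ) : (squarefreeExponent τ).degree = τ.card := by
  simp [squarefreeExponent, map_sum]

theorem squarefreeExponent_insert [DecidableEq σ] {τ : Finset σ} {v : σ} (hv : v ∉ τ) :
    squarefreeExponent (insert v τ) = Finsupp.single v 1 + squarefreeExponent τ :=
  Finset.sum_insert hv

theorem squarefreeExponent_erase [DecidableEq σ] {τ : Finset σ} {v : σ} (hv : v ∈ τ) :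
    Finsupp.single v 1 + squarefreeExponent (τ.erase v) = squarefreeExponent τ :=
  Finset.add_sum_erase _ _ hv

theorem squarefreeExponent_apply_of_notMem {τ : Finset σ} {v : σ} (hv : v ∉ τ) :
    squarefreeExponent τ v = 0 := by
  rw [squarefreeExponent, Finsupp.finsetSum_apply]
  refine Finset.sum_eq_zero fun u hu => Finsupp.single_eq_of_ne ?_
  rintro rfl
  exact hv hu

/-- The part of a Koszul chain whose multidegrees satisfy `Q`. The basis vectors of the Koszul
complex have the multidegrees of the variables, and those of the coefficient module have multidegree
zero. -/
def multidegreePart (Q : (σ →₀ ℕ) → Prop) (f : Finset σ → (B →₀ MvPolynomial σ A)) :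
    Finset σ → (B →₀ MvPolynomial σ A) :=
  fun τ => filterTerms (fun _ m => Q (m + squarefreeExponent τ)) (f τ)

open Classical in
theorem coeff_multidegreePart (Q : (σ →₀ ℕ) → Prop) (f : Finset σ → (B →₀ MvPolynomial σ A))
    (τ : Finset σ) (b : B) (m : σ →₀ ℕ) : (multidegreePart Q f τ b).coeff m =
      if Q (m + squarefreeExponent τ) then (f τ b).coeff m else 0 :=
  coeff_filterTerms _ _ _ _

theorem of_coeff_multidegreePart_ne_zero {Q : (σ →₀ ℕ) → Prop}
    {f : Finset σ → (B →₀ MvPolynomial σ A)} {τ : Finset σ} {b : B} {m : σ →₀ ℕ}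
    (h : (multidegreePart Q f τ b).coeff m ≠ 0) :
    Q (m + squarefreeExponent τ) ∧ (f τ b).coeff m ≠ 0 := by
  classical
  rwa [coeff_multidegreePart, ite_ne_right_iff] at h

variable [LinearOrder σ] [Fintype σ]

theorem coeff_koszul_X (f : Finset σ → (B →₀ MvPolynomial σ A)) (τ : Finset σ) (b : B)
    (m : σ →₀ ℕ) : (koszul (MvPolynomial.X (R := A)) f τ b).coeff m =
      ∑ v ∈ τᶜ, koszulSign v τ •
        if v ∈ m.support then (f (insert v τ) b).coeff (m - Finsupp.single v 1) else 0 := by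
  simp only [koszul_apply, Finsupp.finsetSum_apply, MvPolynomial.coeff_sum, Finsupp.smul_apply,
    MvPolynomial.coeff_smul, smul_eq_mul, MvPolynomial.coeff_X_mul']

theorem koszul_multidegreePart (Q : (σ →₀ ℕ) → Prop) (f : Finset σ → (B →₀ MvPolynomial σ A)) :
    koszul (MvPolynomial.X (R := A)) (multidegreePart Q f) =
      multidegreePart Q (koszul (MvPolynomial.X (R := A)) f) := by
  classical
  funext τ
  ext b m
  simp only [coeff_multidegreePart, coeff_koszul_X]
  have hterm : ∀ v ∈ τᶜ, v ∈ m.support →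
      m - Finsupp.single v 1 + squarefreeExponent (insert v τ) = m + squarefreeExponent τ := by
    intro v hv hm
    have hle : Finsupp.single v 1 ≤ m := by
      rw [Finsupp.single_le_iff]
      exact Nat.one_le_iff_ne_zero.2 (Finsupp.mem_support_iff.1 hm)
    rw [squarefreeExponent_insert (Finset.mem_compl.1 hv), ← add_assoc, tsub_add_cancel_of_le hle]
  rw [Finset.ite_sum_zero]
  refine Finset.sum_congr rfl fun v hv => ?_
  by_cases hm : v ∈ m.support
  · rw [if_pos hm, if_pos hm, hterm v hv hm, smul_ite, smul_zero]
  · rw [if_neg hm, if_neg hm, smul_zero, ite_self]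

/-- The chain `g` is the quotient of `koszulCone v f` by the variable of `v`. -/
theorem exists_koszul_eq_of_apply_ne_zero (v : σ) {f : Finset σ → (B →₀ MvPolynomial σ A)}
    (hf : koszul (MvPolynomial.X (R := A)) f = 0)
    (hv : ∀ τ b m, (f τ b).coeff m ≠ 0 → (m + squarefreeExponent τ) v ≠ 0) :
    ∃ g, koszul (MvPolynomial.X (R := A)) g = f ∧ ∀ τ b m, (g τ b).coeff m ≠ 0 →
      v ∈ τ ∧ (f (τ.erase v) b).coeff (m + Finsupp.single v 1) ≠ 0 := by
  have hcone : ∀ τ b m, (koszulCone v f τ b).coeff m ≠ 0 →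
      v ∈ τ ∧ (f (τ.erase v) b).coeff m ≠ 0 := by
    intro τ b m hne
    have hmem : v ∈ τ := by
      by_contra h
      simp [koszulCone, h] at hne
    rw [koszulCone, if_pos hmem, Finsupp.smul_apply, MvPolynomial.coeff_smul] at hne
    exact ⟨hmem, right_ne_zero_of_smul hne⟩
  let g : Finset σ → (B →₀ MvPolynomial σ A) := fun τ =>
    (koszulCone v f τ).mapRange (MvPolynomial.divMonomial · (Finsupp.single v 1))
      (MvPolynomial.zero_divMonomial _)
  have hg : (MvPolynomial.X v : MvPolynomial σ A) • g = koszulCone v f := by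
    funext τ
    ext b m
    simp only [g, Pi.smul_apply, Finsupp.smul_apply, Finsupp.mapRange_apply, smul_eq_mul,
      MvPolynomial.coeff_X_mul', MvPolynomial.coeff_divMonomial]
    split_ifs with hm
    · rw [add_tsub_cancel_of_le]
      exact Finsupp.single_le_iff.2 (Nat.one_le_iff_ne_zero.2 (Finsupp.mem_support_iff.1 hm))
    · by_contra hne
      obtain ⟨-, h⟩ := hcone τ b m (Ne.symm hne)
      refine hv _ b m h ?_
      rw [Finsupp.add_apply, Finsupp.notMem_support_iff.1 hm,
        squarefreeExponent_apply_of_notMem (Finset.notMem_erase v τ)]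
  refine ⟨g, ?_, fun τ b m hne => ?_⟩
  · have h := koszul_koszulCone_add (MvPolynomial.X (R := A)) v f
    rw [hf, koszulCone_zero, add_zero, ← hg, koszul_smul] at h
    funext τ
    ext1 b
    exact MvPolynomial.X_mul_cancel_left_iff.1 (DFunLike.congr_fun (congrFun h τ) b)
  · rw [add_comm m]
    exact hcone τ b _ hne

theorem exists_koszul_eq {P : (σ →₀ ℕ) → σ → Prop} {f : Finset σ → (B →₀ MvPolynomial σ A)}
    (hf : koszul (MvPolynomial.X (R := A)) f = 0)
    (hP : ∀ τ b m, (f τ b).coeff m ≠ 0 → ∃ v, (m + squarefreeExponent τ) v ≠ 0 ∧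
      P (m + squarefreeExponent τ) v) :
    ∃ g, koszul (MvPolynomial.X (R := A)) g = f ∧ ∀ τ b m, (g τ b).coeff m ≠ 0 → ∃ v ∈ τ,
      P (m + squarefreeExponent τ) v ∧ (f (τ.erase v) b).coeff (m + Finsupp.single v 1) ≠ 0 := by
  classical
  choose w hw using fun a : {a : σ →₀ ℕ // ∃ v, a v ≠ 0 ∧ P a v} => a.2
  let Q (v : σ) (a : σ →₀ ℕ) : Prop := ∃ h, w ⟨a, h⟩ = v
  have hQ {v a} (h : Q v a) : a v ≠ 0 ∧ P a v := by
    obtain ⟨h, rfl⟩ := h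
    exact hw ⟨a, h⟩
  have hsum : ∑ v, multidegreePart (Q v) f = f := by
    funext τ
    ext b m
    simp only [Finset.sum_apply, Finsupp.finsetSum_apply, MvPolynomial.coeff_sum,
      coeff_multidegreePart]
    by_cases hne : (f τ b).coeff m = 0
    · simp [hne]
    · rw [Finset.sum_eq_single (w ⟨_, hP τ b m hne⟩), if_pos ⟨hP τ b m hne, rfl⟩]
      · exact fun v _ hv => if_neg fun h => hv h.2.symm
      · simp
  have hpart (v : σ) : ∃ g, koszul (MvPolynomial.X (R := A)) g = multidegreePart (Q v) f ∧
      ∀ τ b m, (g τ b).coeff m ≠ 0 → v ∈ τ ∧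
        (multidegreePart (Q v) f (τ.erase v) b).coeff (m + Finsupp.single v 1) ≠ 0 := by
    refine exists_koszul_eq_of_apply_ne_zero v ?_ fun τ b m hne => ?_
    · rw [koszul_multidegreePart, hf]
      funext τ
      exact map_zero _
    · exact (hQ (of_coeff_multidegreePart_ne_zero hne).1).1
  choose g hg hg' using hpart
  refine ⟨∑ v, g v, ?_, fun τ b m hne => ?_⟩
  · rw [map_sum, Finset.sum_congr rfl fun v _ => hg v, hsum]
  · simp only [Finset.sum_apply, Finsupp.finsetSum_apply, MvPolynomial.coeff_sum] at hne
    obtain ⟨v, -, hv⟩ := Finset.exists_ne_zero_of_sum_ne_zero hne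
    obtain ⟨hmem, hv⟩ := hg' v τ b m hv
    obtain ⟨hQv, hv⟩ := of_coeff_multidegreePart_ne_zero hv
    rw [add_assoc, squarefreeExponent_erase hmem] at hQv
    exact ⟨v, hmem, (hQ hQv).2, hv⟩

end Multigrading

/-! ### Graded free modules -/

section Graded

variable {σ A B B' : Type*} [CommRing A]

/-- The elements of degree `k` of the graded free module over the standard graded polynomial ring
whose basis vectors have the degrees `deg b`. -/
def freeGrading (deg : B → ℤ) (k : ℤ) : AddSubgroup (B →₀ MvPolynomial σ A) where
  carrier := {x | ∀ b m, (x b).coeff m ≠ 0 → (m.degree : ℤ) + deg b = k}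
  zero_mem' b m h := absurd rfl h
  add_mem' {x y} hx hy b m h := by
    rw [Finsupp.add_apply, MvPolynomial.coeff_add] at h
    by_cases hxm : (x b).coeff m = 0
    · exact hy b m (by rwa [hxm, zero_add] at h)
    · exact hx b m hxm
  neg_mem' {x} hx b m h := hx b m (by simpa using h)

theorem single_monomial_mem_freeGrading (deg : B → ℤ) (b : B) (m : σ →₀ ℕ) (r : A) :
    Finsupp.single b (MvPolynomial.monomial m r) ∈ freeGrading deg ((m.degree : ℤ) + deg b) := by
  classical
  intro b' m' h
  obtain rfl : b' = b := by
    by_contra hb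
    simp [Finsupp.single_eq_of_ne hb] at h
  rw [Finsupp.single_eq_same, MvPolynomial.coeff_monomial, ite_ne_right_iff] at h
  rw [h.1]

theorem monomial_smul_mem_freeGrading {deg : B → ℤ} {k : ℤ} {x : B →₀ MvPolynomial σ A}
    (hx : x ∈ freeGrading deg k) (m : σ →₀ ℕ) (r : A) :
    MvPolynomial.monomial m r • x ∈ freeGrading deg ((m.degree : ℤ) + k) := by
  intro b m' h
  rw [Finsupp.smul_apply, smul_eq_mul, MvPolynomial.coeff_monomial_mul', ite_ne_right_iff] at h
  obtain ⟨m'', rfl⟩ := exists_add_of_le h.1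
  rw [add_tsub_cancel_left] at h
  rw [← hx b m'' (right_ne_zero_of_mul h.2), map_add, Nat.cast_add, add_assoc]

/-- The component of degree `k` of an element of a graded free module. -/
def gradedComponent (deg : B → ℤ) (k : ℤ) :
    (B →₀ MvPolynomial σ A) →+ (B →₀ MvPolynomial σ A) :=
  filterTerms fun b m => (m.degree : ℤ) + deg b = k

theorem coeff_gradedComponent (deg : B → ℤ) (k : ℤ) (x : B →₀ MvPolynomial σ A) (b : B)
    (m : σ →₀ ℕ) : (gradedComponent deg k x b).coeff m =
      if (m.degree : ℤ) + deg b = k then (x b).coeff m else 0 := by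
  rw [gradedComponent, coeff_filterTerms]
  congr

theorem gradedComponent_mem (deg : B → ℤ) (k : ℤ) (x : B →₀ MvPolynomial σ A) :
    gradedComponent deg k x ∈ freeGrading deg k := by
  intro b m h
  rw [coeff_gradedComponent, ite_ne_right_iff] at h
  exact h.1

theorem gradedComponent_of_mem {deg : B → ℤ} {l : ℤ} {x : B →₀ MvPolynomial σ A}
    (hx : x ∈ freeGrading deg l) (k : ℤ) : gradedComponent deg k x = if l = k then x else 0 := by
  ext b m
  rw [coeff_gradedComponent]
  by_cases h : (x b).coeff m = 0
  · split_ifs <;> simp [h]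
  · rw [hx b m h]
    split_ifs <;> rfl

/-- A map between graded free modules that is homogeneous of degree zero. -/
def IsGradedMap (deg' : B' → ℤ) (deg : B → ℤ)
    (φ : (B' →₀ MvPolynomial σ A) →ₗ[MvPolynomial σ A] (B →₀ MvPolynomial σ A)) : Prop :=
  ∀ b, φ (Finsupp.single b 1) ∈ freeGrading deg (deg' b)

namespace IsGradedMap

variable {deg : B → ℤ} {deg' : B' → ℤ}
  {φ : (B' →₀ MvPolynomial σ A) →ₗ[MvPolynomial σ A] (B →₀ MvPolynomial σ A)}

theorem map_gradedComponent (hφ : IsGradedMap deg' deg φ) (k : ℤ) (y : B' →₀ MvPolynomial σ A) :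
    φ (gradedComponent deg' k y) = gradedComponent deg k (φ y) := by
  induction y using Finsupp.induction_linear with
  | zero => simp only [map_zero]
  | add x y hx hy => simp only [map_add, hx, hy]
  | single b f =>
    induction f using MvPolynomial.induction_on' with
    | add p q hp hq => simp only [Finsupp.single_add, map_add, hp, hq]
    | monomial m r =>
      have hφb : φ (Finsupp.single b (MvPolynomial.monomial m r)) ∈
          freeGrading deg ((m.degree : ℤ) + deg' b) := by
        have h := monomial_smul_mem_freeGrading (hφ b) m r
        rwa [← map_smul, Finsupp.smul_single, smul_eq_mul, mul_one] at h
      rw [gradedComponent_of_mem (single_monomial_mem_freeGrading deg' b m r),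
        gradedComponent_of_mem hφb, apply_ite φ, map_zero]

theorem map_mem (hφ : IsGradedMap deg' deg φ) {k : ℤ} {y : B' →₀ MvPolynomial σ A}
    (hy : y ∈ freeGrading deg' k) : φ y ∈ freeGrading deg k := by
  have h : gradedComponent deg' k y = y := by rw [gradedComponent_of_mem hy, if_pos rfl]
  rw [← h, hφ.map_gradedComponent]
  exact gradedComponent_mem deg k _

theorem exists_mem_of_mem_range (hφ : IsGradedMap deg' deg φ) {k : ℤ} {x : B →₀ MvPolynomial σ A}
    (hx : x ∈ freeGrading deg k) (hr : x ∈ LinearMap.range φ) :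
    ∃ y ∈ freeGrading deg' k, φ y = x := by
  obtain ⟨y, rfl⟩ := hr
  refine ⟨gradedComponent deg' k y, gradedComponent_mem deg' k y, ?_⟩
  rw [hφ.map_gradedComponent, gradedComponent_of_mem hx, if_pos rfl]

end IsGradedMap

/-- The reduction of an element of a free module modulo the variables. -/
def constantTerms : (B →₀ MvPolynomial σ A) →+ (B →₀ A) :=
  Finsupp.mapRange.addMonoidHom MvPolynomial.constantCoeff.toAddMonoidHom

theorem constantTerms_smul (p : MvPolynomial σ A) (x : B →₀ MvPolynomial σ A) :
    constantTerms (p • x) = MvPolynomial.constantCoeff p • constantTerms x := by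
  ext b
  exact map_mul MvPolynomial.constantCoeff p (x b)

end Graded

/-! ### Graded strands of Koszul complexes -/

section Strands

variable {σ A B B' : Type*} [CommRing A]

/-- The Koszul chains of homological degree `q` and internal degree `j` with coefficients in a
submodule `N` of a graded free module. -/
def koszulChains (deg : B → ℤ) (N : Submodule (MvPolynomial σ A) (B →₀ MvPolynomial σ A)) (j : ℤ)
    (q : ℕ) : AddSubgroup (Finset σ → (B →₀ MvPolynomial σ A)) where
  carrier := {f | ∀ τ, f τ ∈ freeGrading deg (j - q) ∧ f τ ∈ N ∧ (τ.card ≠ q → f τ = 0)}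
  zero_mem' _ := ⟨zero_mem _, zero_mem _, fun _ => rfl⟩
  add_mem' hf hg τ := ⟨add_mem (hf τ).1 (hg τ).1, add_mem (hf τ).2.1 (hg τ).2.1, fun h => by
    rw [Pi.add_apply, (hf τ).2.2 h, (hg τ).2.2 h, add_zero]⟩
  neg_mem' hf τ := ⟨neg_mem (hf τ).1, neg_mem (hf τ).2.1, fun h => by
    rw [Pi.neg_apply, (hf τ).2.2 h, neg_zero]⟩

variable {deg : B → ℤ} {deg' : B' → ℤ} {j : ℤ} {q : ℕ}
  {φ : (B' →₀ MvPolynomial σ A) →ₗ[MvPolynomial σ A] (B →₀ MvPolynomial σ A)}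

theorem comp_mem_koszulChains (hφ : IsGradedMap deg' deg φ)
    {f : Finset σ → (B' →₀ MvPolynomial σ A)} (hf : f ∈ koszulChains deg' ⊤ j q) :
    φ ∘ f ∈ koszulChains deg (LinearMap.range φ) j q := fun τ =>
  ⟨hφ.map_mem (hf τ).1, LinearMap.mem_range_self φ _, fun h => by
    rw [Function.comp_apply, (hf τ).2.2 h, map_zero]⟩

theorem exists_comp_eq_of_mem_koszulChains_range (hφ : IsGradedMap deg' deg φ)
    {f : Finset σ → (B →₀ MvPolynomial σ A)} (hf : f ∈ koszulChains deg (LinearMap.range φ) j q) :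
    ∃ g ∈ koszulChains deg' ⊤ j q, φ ∘ g = f := by
  have hlift : ∀ τ, ∃ y ∈ freeGrading deg' (j - q), φ y = f τ ∧ (τ.card ≠ q → y = 0) := by
    intro τ
    by_cases hτ : τ.card = q
    · obtain ⟨y, hy, hyf⟩ := hφ.exists_mem_of_mem_range (hf τ).1 (hf τ).2.1
      exact ⟨y, hy, hyf, absurd hτ⟩
    · exact ⟨0, zero_mem _, by rw [map_zero, (hf τ).2.2 hτ], fun _ => rfl⟩
  choose g hg hgf hg0 using hlift
  exact ⟨g, fun τ => ⟨hg τ, Submodule.mem_top, hg0 τ⟩, funext hgf⟩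

variable [LinearOrder σ] {N : Submodule (MvPolynomial σ A) (B →₀ MvPolynomial σ A)}

theorem mem_koszulChains_succ {f g : Finset σ → (B →₀ MvPolynomial σ A)}
    (hf : f ∈ koszulChains deg N j q)
    (hg : ∀ τ b m, (g τ b).coeff m ≠ 0 →
      ∃ v ∈ τ, (f (τ.erase v) b).coeff (m + Finsupp.single v 1) ≠ 0) :
    g ∈ koszulChains deg ⊤ j (q + 1) := by
  intro τ
  refine ⟨fun b m h => ?_, Submodule.mem_top, fun hτ => ?_⟩
  · obtain ⟨v, -, hv⟩ := hg τ b m h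
    have hdeg := (hf (τ.erase v)).1 b _ hv
    rw [map_add, Finsupp.degree_single] at hdeg
    push_cast at hdeg ⊢
    linarith
  · ext b m
    by_contra h
    obtain ⟨v, hvτ, hv⟩ := hg τ b m h
    rw [(hf (τ.erase v)).2.2 fun h' => hτ (by rw [← h', Finset.card_erase_add_one hvτ])] at hv
    exact hv rfl

theorem single_empty_mem_koszulChains {x : B →₀ MvPolynomial σ A} (hx : x ∈ freeGrading deg j)
    (hN : x ∈ N) : Pi.single ∅ x ∈ koszulChains deg N j 0 := by
  intro τ
  rcases eq_or_ne τ ∅ with rfl | hτ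
  · simpa using ⟨hx, hN⟩
  · rw [Pi.single_eq_of_ne hτ]
    exact ⟨zero_mem _, zero_mem _, fun _ => rfl⟩

variable [Fintype σ]

theorem koszul_mem_koszulChains {f : Finset σ → (B →₀ MvPolynomial σ A)}
    (hf : f ∈ koszulChains deg N j (q + 1)) :
    koszul (MvPolynomial.X (R := A)) f ∈ koszulChains deg N j q := by
  intro τ
  refine ⟨sum_mem fun v _ => zsmul_mem ?_ _,
    sum_mem fun v _ => zsmul_mem (N.smul_mem _ (hf _).2.1) _,
    fun h => Finset.sum_eq_zero fun v hv => ?_⟩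
  · have h := monomial_smul_mem_freeGrading (hf (insert v τ)).1 (Finsupp.single v 1) 1
    rwa [Finsupp.degree_single, Nat.cast_one, Nat.cast_succ, add_sub_left_comm, add_comm (q : ℤ),
      sub_add_cancel_left, ← sub_eq_add_neg] at h
  · rw [(hf (insert v τ)).2.2, smul_zero, smul_zero]
    rwa [Finset.card_insert_of_notMem (Finset.mem_compl.1 hv), Ne, add_left_inj]

/-- The boundaries in `koszulChains deg N j q`. -/
def koszulBoundaries (deg : B → ℤ) (N : Submodule (MvPolynomial σ A) (B →₀ MvPolynomial σ A))
    (j : ℤ) (q : ℕ) : AddSubgroup (Finset σ → (B →₀ MvPolynomial σ A)) :=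
  (koszulChains deg N j (q + 1)).map (koszul (MvPolynomial.X (R := A)))

theorem constantTerms_koszul_X (f : Finset σ → (B →₀ MvPolynomial σ A)) (τ : Finset σ) :
    constantTerms (koszul (MvPolynomial.X (R := A)) f τ) = 0 := by
  rw [koszul_apply, map_sum]
  refine Finset.sum_eq_zero fun v _ => ?_
  rw [map_zsmul, constantTerms_smul, MvPolynomial.constantCoeff_X, zero_smul, smul_zero]

theorem mem_koszulBoundaries_top {f : Finset σ → (B →₀ MvPolynomial σ A)}
    (hf : f ∈ koszulChains deg ⊤ j q) (hcycle : koszul (MvPolynomial.X (R := A)) f = 0)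
    (hconst : q = 0 → constantTerms (f ∅) = 0) : f ∈ koszulBoundaries deg ⊤ j q := by
  obtain ⟨g, hg, hgf⟩ := exists_koszul_eq (P := fun _ _ => True) hcycle fun τ b m hne => by
    simp only [and_true]
    refine (DFunLike.ne_iff (F := σ →₀ ℕ) (g := 0)).1 fun h => ?_
    obtain ⟨rfl, hτ⟩ := add_eq_zero.1 h
    obtain rfl : τ = ∅ := by
      rw [← Finset.card_eq_zero, ← degree_squarefreeExponent, hτ, map_zero]
    have hq : q = 0 := by
      by_contra hq
      rw [(hf ∅).2.2 (Ne.symm hq)] at hne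
      exact hne rfl
    exact hne (DFunLike.congr_fun (hconst hq) b)
  refine ⟨g, mem_koszulChains_succ hf fun τ b m h => ?_, hg⟩
  obtain ⟨v, hv, -, h⟩ := hgf τ b m h
  exact ⟨v, hv, h⟩

/-- The strand of internal degree `j` of the Koszul homology `H_q(N)` is mapped injectively into
that of the ambient free module. -/
def KoszulInjective (deg : B → ℤ) (N : Submodule (MvPolynomial σ A) (B →₀ MvPolynomial σ A))
    (j : ℤ) (q : ℕ) : Prop :=
  koszulChains deg N j q ⊓ koszulBoundaries deg ⊤ j q ≤ koszulBoundaries deg N j q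

/-- The connecting homomorphism of `0 → ker φ → F' → range φ → 0` identifies the obstructions. -/
theorem KoszulInjective.ker (hφ : IsGradedMap deg' deg φ)
    (h : KoszulInjective deg (LinearMap.range φ) j (q + 1)) :
    KoszulInjective deg' (LinearMap.ker φ) j q := by
  rintro _ ⟨hf, g, hg, rfl⟩
  have hcycle : koszul (MvPolynomial.X (R := A)) (φ ∘ g) = 0 := by
    rw [koszul_comp]
    exact funext fun τ => (hf τ).2.1
  have hφg := comp_mem_koszulChains hφ hg
  have hφg_top : φ ∘ g ∈ koszulChains deg ⊤ j (q + 1) := fun τ =>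
    ⟨(hφg τ).1, Submodule.mem_top, (hφg τ).2.2⟩
  obtain ⟨_, hh, hhg⟩ := h ⟨hφg, mem_koszulBoundaries_top hφg_top hcycle fun h => by simp at h⟩
  obtain ⟨h', hh', rfl⟩ := exists_comp_eq_of_mem_koszulChains_range hφ hh
  have hsub := sub_mem hg (koszul_mem_koszulChains hh')
  refine ⟨g - koszul (MvPolynomial.X (R := A)) h', fun τ => ⟨(hsub τ).1, ?_, (hsub τ).2.2⟩, ?_⟩
  · rw [LinearMap.mem_ker, Pi.sub_apply, map_sub, sub_eq_zero]
    have hτ := congrFun hhg τ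
    rw [koszul_comp] at hτ
    exact hτ.symm
  · rw [map_sub, koszul_koszul, sub_zero]

theorem koszul_single_empty (x : B →₀ MvPolynomial σ A) :
    koszul (MvPolynomial.X (R := A)) (Pi.single (∅ : Finset σ) x) = 0 := by
  funext τ
  refine Finset.sum_eq_zero fun v _ => ?_
  rw [Pi.single_eq_of_ne (Finset.insert_ne_empty v τ), smul_zero, smul_zero]

theorem exists_mem_ker_constantTerms_eq (hφ : IsGradedMap deg' deg φ)
    {x : B' →₀ MvPolynomial σ A} (hx : x ∈ freeGrading deg' j)
    (h : Pi.single ∅ (φ x) ∈ koszulBoundaries deg (LinearMap.range φ) j 0) :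
    ∃ y ∈ freeGrading deg' j, φ y = 0 ∧ constantTerms y = constantTerms x := by
  obtain ⟨_, hφg, hgx⟩ := h
  obtain ⟨g, hg, rfl⟩ := exists_comp_eq_of_mem_koszulChains_range hφ hφg
  refine ⟨x - koszul (MvPolynomial.X (R := A)) g ∅, sub_mem hx ?_, ?_, ?_⟩
  · have h0 := (koszul_mem_koszulChains hg ∅).1
    rwa [Nat.cast_zero, sub_zero] at h0
  · have h0 := congrFun hgx ∅
    rw [koszul_comp, Pi.single_eq_same] at h0
    rw [map_sub, sub_eq_zero]
    exact h0.symm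
  · rw [map_sub, constantTerms_koszul_X, sub_zero]

end Strands

/-! ### Vanishing of Tor for monomial ideals -/

section Vanishing

variable {K σ : Type*} [Field K] {I : Ideal (MvPolynomial σ K)}

theorem IsMonomialIdeal.monomial_mem (hI : IsMonomialIdeal I) {f : MvPolynomial σ K} (hf : f ∈ I)
    {m : σ →₀ ℕ} (hm : f.coeff m ≠ 0) : MvPolynomial.monomial m (1 : K) ∈ I := by
  classical
  obtain ⟨s, rfl⟩ := hI
  rw [MvPolynomial.mem_ideal_span_monomial_image] at hf ⊢
  intro m' hm'
  obtain rfl : m' = m := Finset.mem_singleton.1 (MvPolynomial.support_monomial_subset hm')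
  exact hf _ (MvPolynomial.mem_support_iff.2 hm)

theorem mem_of_forall_monomial_mem {f : MvPolynomial σ K}
    (h : ∀ m, f.coeff m ≠ 0 → MvPolynomial.monomial m (1 : K) ∈ I) : f ∈ I := by
  rw [f.as_sum]
  refine sum_mem fun m hm => ?_
  rw [← mul_one (f.coeff m), ← MvPolynomial.C_mul_monomial]
  exact I.mul_mem_left _ (h m (MvPolynomial.mem_support_iff.1 hm))

/-- The vertex `v` is a cone point, as far as faces with `p` elements are concerned, of the upper
Koszul simplicial complex of `I` in the multidegree `a`. The faces of this complex are the `ρ` such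
that the monomial with exponent vector `a - squarefreeExponent ρ` lies in `I`. -/
def IsConePoint (I : Ideal (MvPolynomial σ K)) (p : ℕ) (a : σ →₀ ℕ) (v : σ) : Prop :=
  a v ≠ 0 ∧ ∀ (ρ : Finset σ) (b : σ →₀ ℕ), ρ.card = p → v ∉ ρ →
    b + Finsupp.single v 1 + squarefreeExponent ρ = a →
      MvPolynomial.monomial (b + Finsupp.single v 1) (1 : K) ∈ I → MvPolynomial.monomial b 1 ∈ I

/-- The ideal `I` as a submodule of the graded free module with one basis vector. -/
def idealSubmodule (I : Ideal (MvPolynomial σ K)) :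
    Submodule (MvPolynomial σ K) (Unit →₀ MvPolynomial σ K) :=
  Submodule.comap (Finsupp.lapply ()) I

theorem mem_koszulBoundaries_idealSubmodule [LinearOrder σ] [Fintype σ] (hI : IsMonomialIdeal I)
    {p : ℕ} {j : ℤ} (hcone : ∀ a : σ →₀ ℕ, (a.degree : ℤ) = j → ∃ v, IsConePoint I p a v)
    {f : Finset σ → (Unit →₀ MvPolynomial σ K)} (hf : f ∈ koszulChains 0 (idealSubmodule I) j p)
    (hcycle : koszul (MvPolynomial.X (R := K)) f = 0) :
    f ∈ koszulBoundaries 0 (idealSubmodule I) j p := by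
  have hcard {τ b m} (h : (f τ b).coeff m ≠ 0) : τ.card = p := by
    by_contra hτ
    rw [(hf τ).2.2 hτ] at h
    exact h rfl
  obtain ⟨g, hg, hgf⟩ := exists_koszul_eq (P := IsConePoint I p) hcycle fun τ b m h => by
    obtain ⟨v, hv⟩ := hcone (m + squarefreeExponent τ) <| by
      have hdeg := (hf τ).1 b m h
      rw [map_add, degree_squarefreeExponent, hcard h, Nat.cast_add]
      simpa [eq_sub_iff_add_eq] using hdeg
    exact ⟨v, hv.1, hv⟩
  have hg' := mem_koszulChains_succ hf fun τ b m h => by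
    obtain ⟨v, hvτ, -, hv⟩ := hgf τ b m h
    exact ⟨v, hvτ, hv⟩
  refine ⟨g, fun τ => ⟨(hg' τ).1, mem_of_forall_monomial_mem fun m h => ?_, (hg' τ).2.2⟩, hg⟩
  obtain ⟨v, hvτ, hv, hne⟩ := hgf τ () m h
  refine hv.2 (τ.erase v) m (hcard hne) (Finset.notMem_erase v τ) ?_
    (hI.monomial_mem (hf (τ.erase v)).2.1 hne)
  rw [add_assoc, squarefreeExponent_erase hvτ]

namespace GradedFreeResolution

variable (F : GradedFreeResolution I)

/-- The augmentation as a homogeneous map into the graded free module with one basis vector. -/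
def augmentation : (F.B 0 →₀ MvPolynomial σ K) →ₗ[MvPolynomial σ K] (Unit →₀ MvPolynomial σ K) :=
  Finsupp.lsingle () ∘ₗ F.aug

theorem isGradedMap_augmentation : IsGradedMap (F.deg 0) 0 F.augmentation := fun b u m h => by
  rw [F.homogeneous_aug b m (by simpa [augmentation] using h), Pi.zero_apply, add_zero]

theorem isGradedMap_d (p : ℕ) : IsGradedMap (F.deg (p + 1)) (F.deg p) (F.d p) := fun b b' m h => by
  rw [F.homogeneous_d p b b' m h, add_comm]

theorem range_augmentation : LinearMap.range F.augmentation = idealSubmodule I := by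
  ext x
  have hmem : x ∈ idealSubmodule I ↔ x () ∈ LinearMap.range F.aug := by
    rw [F.range_aug]
    rfl
  rw [hmem]
  refine ⟨?_, fun ⟨y, hy⟩ => ⟨y, Finsupp.unique_ext ?_⟩⟩
  · rintro ⟨y, rfl⟩
    exact ⟨y, by simp [augmentation]⟩
  · simpa [augmentation] using hy

theorem ker_augmentation : LinearMap.ker F.augmentation = LinearMap.range (F.d 0) := by
  ext x
  rw [LinearMap.mem_ker, augmentation, LinearMap.comp_apply, Finsupp.lsingle_apply,
    Finsupp.single_eq_zero]
  exact F.exact_aug x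

theorem ker_d (p : ℕ) : LinearMap.ker (F.d p) = LinearMap.range (F.d (p + 1)) := by
  ext x
  exact F.exact_d p x

theorem dBar_constantTerms (p : ℕ) (x : F.B (p + 1) →₀ MvPolynomial σ K) :
    F.dBar p (constantTerms x) = constantTerms (F.d p x) := by
  induction x using Finsupp.induction_linear with
  | zero => simp only [map_zero]
  | add x y hx hy => simp only [map_add, hx, hy]
  | single b f =>
    have hsingle : Finsupp.single b f = f • Finsupp.single b (1 : MvPolynomial σ K) := by simp
    have hconst : constantTerms (Finsupp.single b (1 : MvPolynomial σ K)) =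
        Finsupp.single b (1 : K) := by
      simp [constantTerms]
    rw [hsingle, (F.d p).map_smul, constantTerms_smul, constantTerms_smul, map_smul, hconst, dBar,
      Finsupp.linearCombination_single, one_smul]
    rfl

theorem exists_mem_freeGrading_constantTerms_eq {p : ℕ} {j : ℤ} {z : F.B p →₀ K}
    (hz : z ∈ F.degreePart p j) :
    ∃ x ∈ freeGrading (σ := σ) (F.deg p) j, constantTerms x = z := by
  classical
  refine ⟨z.mapRange MvPolynomial.C (map_zero _), fun b m h => ?_, by ext b; simp [constantTerms]⟩
  rw [Finsupp.mapRange_apply, MvPolynomial.coeff_C, ite_ne_right_iff] at h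
  rw [← h.1, (Finsupp.mem_supported K z).1 hz (Finsupp.mem_support_iff.2 h.2)]
  simp

theorem constantTerms_mem_degreePart {p : ℕ} {j : ℤ} {x : F.B p →₀ MvPolynomial σ K}
    (hx : x ∈ freeGrading (F.deg p) j) : constantTerms x ∈ F.degreePart p j := by
  refine (Finsupp.mem_supported K _).2 fun b hb => ?_
  simpa using hx b 0 ((Finsupp.mem_support_iff (f := constantTerms x)).1 hb)

theorem constantTerms_mem_boundaries {p : ℕ} {j : ℤ} {y : F.B p →₀ MvPolynomial σ K}
    (hy : y ∈ freeGrading (F.deg p) j) (hr : y ∈ LinearMap.range (F.d p)) :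
    constantTerms y ∈ F.boundaries p j := by
  obtain ⟨y', hy', rfl⟩ := (F.isGradedMap_d p).exists_mem_of_mem_range hy hr
  exact ⟨constantTerms y', F.constantTerms_mem_degreePart hy', F.dBar_constantTerms p y'⟩

theorem koszulInjective_range_d [LinearOrder σ] [Fintype σ] {p q : ℕ} {j : ℤ}
    (h : KoszulInjective 0 (idealSubmodule I) j (q + p + 1)) :
    KoszulInjective (F.deg p) (LinearMap.range (F.d p)) j q := by
  induction p generalizing q with
  | zero =>
    rw [← F.range_augmentation] at h
    rw [← F.ker_augmentation]
    exact h.ker F.isGradedMap_augmentation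
  | succ p ih =>
    rw [← F.ker_d]
    refine KoszulInjective.ker (F.isGradedMap_d p) (ih ?_)
    rwa [add_right_comm q 1 p]

theorem cycles_le_boundaries [Finite σ] (hI : IsMonomialIdeal I) {p : ℕ} {j : ℤ}
    (hcone : ∀ a : σ →₀ ℕ, (a.degree : ℤ) = j → ∃ v, IsConePoint I p a v) :
    F.cycles p j ≤ F.boundaries p j := by
  have := Fintype.ofFinite σ
  let _ : LinearOrder σ := LinearOrder.lift' (Fintype.equivFin σ) (Fintype.equivFin σ).injective
  have hexact {f} (hf : f ∈ koszulChains 0 (idealSubmodule I) j p)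
      (hcycle : koszul (MvPolynomial.X (R := K)) f = 0) :=
    mem_koszulBoundaries_idealSubmodule hI hcone hf hcycle
  intro z hz
  cases p with
  | zero =>
    obtain ⟨x, hx, rfl⟩ := F.exists_mem_freeGrading_constantTerms_eq hz
    rw [← F.range_augmentation] at hexact
    obtain ⟨y, hy, hy0, hyx⟩ := exists_mem_ker_constantTerms_eq F.isGradedMap_augmentation hx <|
      hexact (single_empty_mem_koszulChains (F.isGradedMap_augmentation.map_mem hx)
        (LinearMap.mem_range_self _ x)) (koszul_single_empty _)
    rw [← hyx]
    refine F.constantTerms_mem_boundaries hy ?_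
    rwa [← F.ker_augmentation]
  | succ p =>
    obtain ⟨x, hx, rfl⟩ := F.exists_mem_freeGrading_constantTerms_eq hz.1
    have hinj : KoszulInjective (F.deg p) (LinearMap.range (F.d p)) j 0 := by
      refine F.koszulInjective_range_d ?_
      rintro f ⟨hf, g, -, rfl⟩
      rw [zero_add] at hf ⊢
      exact hexact hf (koszul_koszul _ g)
    have hdx := (F.isGradedMap_d p).map_mem hx
    obtain ⟨y, hy, hy0, hyx⟩ := exists_mem_ker_constantTerms_eq (F.isGradedMap_d p) hx <|
      hinj ⟨single_empty_mem_koszulChains hdx (LinearMap.mem_range_self _ x),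
        mem_koszulBoundaries_top (single_empty_mem_koszulChains hdx Submodule.mem_top)
          (koszul_single_empty _) fun _ => by
            rw [Pi.single_eq_same, ← F.dBar_constantTerms]
            exact hz.2⟩
    rw [← hyx]
    refine F.constantTerms_mem_boundaries hy ?_
    rwa [← F.ker_d]

end GradedFreeResolution

theorem reg_le_of_exists_isConePoint [Finite σ] (hI : IsMonomialIdeal I) {M : ℕ}
    (hcone : ∀ p (a : σ →₀ ℕ), M + p < a.degree → ∃ v, IsConePoint I p a v) :
    reg I ≤ (((M : ℤ) : ℝ) : EReal) := by
  refine iSup_le fun p => iSup_le fun j => iSup_le fun ⟨F, z, hz, hz'⟩ => ?_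
  rw [EReal.coe_le_coe_iff, Int.cast_le]
  by_contra! hlt
  refine hz' (F.cycles_le_boundaries hI (fun a ha => hcone p a ?_) hz)
  omega

end Vanishing

/-! ### Monomials up to the action of `Inc(ℕ)^i` -/

section Columns

variable {c : ℕ}

/-- The maps that occur as restrictions of elements of `Inc(ℕ)^i`. -/
def FixesInitial (i : ℕ) {m n : ℕ} (φ : Fin m ↪o Fin n) : Prop :=
  ∀ j : Fin m, (j : ℕ) < i → (φ j : ℕ) = j

/-- The action of a map of column indices on (exponent vectors of) monomials. -/
def mapColumns {m n : ℕ} (φ : Fin m ↪o Fin n) (u : Fin c × Fin m →₀ ℕ) : Fin c × Fin n →₀ ℕ :=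
  u.mapDomain (Prod.map id φ)

variable {l m n : ℕ} (φ : Fin m ↪o Fin n)

theorem mapColumns_apply (u : Fin c × Fin m →₀ ℕ) (k : Fin c) (j : Fin m) :
    mapColumns φ u (k, φ j) = u (k, j) :=
  Finsupp.mapDomain_apply (Function.injective_id.prodMap φ.injective) u (k, j)

theorem mapColumns_apply_of_notMem_range (u : Fin c × Fin m →₀ ℕ) (k : Fin c) {j : Fin n}
    (hj : j ∉ Set.range φ) : mapColumns φ u (k, j) = 0 := by
  refine Finsupp.mapDomain_of_notMem_range _ _ ?_
  rintro ⟨v, hv⟩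
  exact hj ⟨v.2, congrArg Prod.snd hv⟩

theorem mapColumns_mapColumns (ψ : Fin l ↪o Fin m) (u : Fin c × Fin l →₀ ℕ) :
    mapColumns φ (mapColumns ψ u) = mapColumns (ψ.trans φ) u :=
  Finsupp.mapDomain_comp.symm

theorem mapColumns_le_iff {u : Fin c × Fin m →₀ ℕ} {b : Fin c × Fin n →₀ ℕ} :
    mapColumns φ u ≤ b ↔ ∀ k j, u (k, j) ≤ b (k, φ j) := by
  refine ⟨fun h k j => (mapColumns_apply φ u k j).symm.trans_le (h _), fun h => ?_⟩
  rintro ⟨k, j⟩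
  by_cases hj : j ∈ Set.range φ
  · obtain ⟨j, rfl⟩ := hj
    exact (mapColumns_apply φ u k j).trans_le (h k j)
  · exact (mapColumns_apply_of_notMem_range φ u k hj).trans_le (Nat.zero_le _)

theorem mapColumns_le_mapColumns {u v : Fin c × Fin m →₀ ℕ} :
    mapColumns φ u ≤ mapColumns φ v ↔ u ≤ v := by
  simp only [mapColumns_le_iff, mapColumns_apply]
  exact ⟨fun h v => h v.1 v.2, fun h k j => h (k, j)⟩

/-- Divisibility of monomials in varying numbers of columns up to the action of `Inc(ℕ)^i`. -/
def ColumnLE (i : ℕ) (x y : Σ n, (Fin c × Fin n →₀ ℕ)) : Prop :=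
  ∃ φ : Fin x.1 ↪o Fin y.1, FixesInitial i φ ∧ mapColumns φ x.2 ≤ y.2

/-- The word formed by the columns of a monomial. The two tags of a column can only be increased
simultaneously if they stay the same, so embeddings of words fix the first `i` columns. -/
def columnWord (i : ℕ) (u : Fin c × Fin n →₀ ℕ) : List ((Fin c → ℕ) × ℕ × ℕ) :=
  List.ofFn fun j : Fin n => (fun k => u (k, j), min (j : ℕ) i, i - min (j : ℕ) i)

theorem columnLE_of_sublistForall₂ {i : ℕ} {x y : Σ n, (Fin c × Fin n →₀ ℕ)}
    (h : List.SublistForall₂ (· ≤ ·) (columnWord i x.2) (columnWord i y.2)) : ColumnLE i x y := by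
  obtain ⟨l, hl, hsub⟩ := List.sublistForall₂_iff.1 h
  obtain ⟨f, hf⟩ := List.sublist_iff_exists_fin_orderEmbedding_get_eq.1 hsub
  have hx : (columnWord i x.2).length = x.1 := List.length_ofFn
  have hy : (columnWord i y.2).length = y.1 := List.length_ofFn
  let e := Fin.castOrderIso (hx.symm.trans hl.length_eq)
  let φ : Fin x.1 ↪o Fin y.1 := (e.toOrderEmbedding.trans f).trans (Fin.castOrderIso hy)
  have hφ (j : Fin x.1) : (∀ k, x.2 (k, j) ≤ y.2 (k, φ j)) ∧
      min (j : ℕ) i ≤ min (φ j : ℕ) i ∧ i - min (j : ℕ) i ≤ i - min (φ j : ℕ) i := by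
    have hj : (columnWord i x.2).get (Fin.cast hx.symm j) ≤ (columnWord i y.2).get (f (e j)) := by
      rw [← hf]
      exact hl.get _ _
    simp only [columnWord, List.get_eq_getElem, List.getElem_ofFn] at hj
    exact ⟨hj.1, hj.2.1, hj.2.2⟩
  refine ⟨φ, fun j hj => ?_, (mapColumns_le_iff φ).2 fun k j => (hφ j).1 k⟩
  have := (hφ j).2
  omega

theorem wellQuasiOrdered_columnLE (i : ℕ) : WellQuasiOrdered (ColumnLE (c := c) i) := by
  intro f
  have hpwo := Set.PartiallyWellOrderedOn.partiallyWellOrderedOn_sublistForall₂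
    (α := (Fin c → ℕ) × ℕ × ℕ) (· ≤ ·) (s := Set.univ)
    (Set.partiallyWellOrderedOn_univ_iff.2 wellQuasiOrdered_le)
  obtain ⟨a, b, hab, h⟩ := hpwo.exists_lt (f := fun t => columnWord i (f t).2)
    fun _ _ _ => Set.mem_univ _
  exact ⟨a, b, hab, columnLE_of_sublistForall₂ h⟩

theorem exists_finset_of_wellQuasiOrdered {α : Type*} {r : α → α → Prop} (hr : WellQuasiOrdered r)
    (s : Set α) : ∃ t : Finset α, ↑t ⊆ s ∧ ∀ y ∈ s, ∃ x ∈ t, r x y := by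
  by_contra! h
  obtain ⟨f, -, hf⟩ := exists_seq_of_forall_finset_exists (· ∈ s) (fun x y => ¬ r x y) h
  obtain ⟨a, b, hab, hr⟩ := hr f
  exact hf a b hab hr

end Columns

section Generators

theorem monomial_mem_of_le {σ A : Type*} [CommSemiring A] {J : Ideal (MvPolynomial σ A)}
    {u b : σ →₀ ℕ} (hu : MvPolynomial.monomial u (1 : A) ∈ J) (h : u ≤ b) :
    MvPolynomial.monomial b (1 : A) ∈ J := by
  rw [← tsub_add_cancel_of_le h, ← one_mul (1 : A), ← MvPolynomial.monomial_mul]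
  exact J.mul_mem_left _ hu

variable {K : Type*} [Field K]

theorem exists_mem_minGens_le {σ : Type*} {J : Ideal (MvPolynomial σ K)} {b : σ →₀ ℕ}
    (hb : MvPolynomial.monomial b (1 : K) ∈ J) : ∃ u ∈ minGens J, u ≤ b := by
  obtain ⟨u, hu, hu'⟩ := exists_minimal_le_of_wellFoundedLT
    (fun v => MvPolynomial.monomial v (1 : K) ∈ J) b hb
  exact ⟨u, hu', hu⟩

variable {c i : ℕ} {I : ∀ n, Ideal (R K c n)}

theorem exists_mem_Inc_extending {m n : ℕ} (him : i < m) {φ : Fin m ↪o Fin n}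
    (hφ : FixesInitial i φ) : ∃ π ∈ Inc i, ∀ j : Fin m, π j = φ j := by
  have hext (j : Fin m) : (if h : (j : ℕ) < m then (φ ⟨j, h⟩ : ℕ) else j + n) = φ j :=
    dif_pos j.isLt
  refine ⟨fun j => if h : j < m then φ ⟨j, h⟩ else j + n, ⟨fun a b hab => ?_, fun j hj => ?_⟩, hext⟩
  · by_cases hb : b < m
    · simpa [hb, hab.trans hb] using hab
    · by_cases ha : a < m
      · simp only [ha, hb, dite_true, dite_false]
        have := (φ ⟨a, ha⟩).isLt
        omega
      · simpa [ha, hb] using hab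
  · exact (hext ⟨j, hj.trans him⟩).trans (hφ _ hj)

theorem monomial_mapColumns_mem (hinv : IsInvariantChain i I) {m n : ℕ} (him : i < m)
    {φ : Fin m ↪o Fin n} (hφ : FixesInitial i φ) {u : Fin c × Fin m →₀ ℕ}
    (hu : MvPolynomial.monomial u (1 : K) ∈ I m) :
    MvPolynomial.monomial (mapColumns φ u) (1 : K) ∈ I n := by
  obtain ⟨π, hπ, hπφ⟩ := exists_mem_Inc_extending him hφ
  have hlt (j : ℕ) (hj : j < m) : π j < n := (hπφ ⟨j, hj⟩).trans_lt (φ _).isLt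
  have hmn : m ≤ n := by simpa using Fintype.card_le_of_embedding φ.toEmbedding
  have h := hinv m n (Nat.one_le_of_lt him) hmn π hπ hlt _ hu
  rw [act, MvPolynomial.rename_monomial] at h
  have hmap : Prod.map id φ = fun v : Fin c × Fin m => (v.1, ⟨π v.2, hlt v.2 v.2.isLt⟩) :=
    funext fun v => Prod.ext rfl (Fin.ext (hπφ v.2).symm)
  rwa [mapColumns, hmap]

/-- Every monomial of the chain in more than `i` columns is divisible by the image, under the action
of `Inc(ℕ)^i`, of a monomial of the chain in at most `r` columns with exponents at most `B`. -/
def IsGeneratedUpTo (i r B : ℕ) (I : ∀ n, Ideal (R K c n)) : Prop :=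
  ∀ n, i < n → ∀ u, MvPolynomial.monomial u (1 : K) ∈ I n → ∃ m, i < m ∧ m ≤ r ∧
    ∃ g, MvPolynomial.monomial g (1 : K) ∈ I m ∧ (∀ v, g v ≤ B) ∧
      ∃ φ : Fin m ↪o Fin n, FixesInitial i φ ∧ mapColumns φ g ≤ u

theorem exists_isGeneratedUpTo (i : ℕ) (I : ∀ n, Ideal (R K c n)) :
    ∃ r B, IsGeneratedUpTo i r B I := by
  obtain ⟨t, ht, hdiv⟩ := exists_finset_of_wellQuasiOrdered (wellQuasiOrdered_columnLE i)
    {x : Σ n, (Fin c × Fin n →₀ ℕ) | i < x.1 ∧ MvPolynomial.monomial x.2 (1 : K) ∈ I x.1}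
  let maxExponent (x : Σ n, (Fin c × Fin n →₀ ℕ)) : ℕ := Finset.univ.sup x.2
  refine ⟨t.sup Sigma.fst, t.sup maxExponent, fun n hn u hu => ?_⟩
  obtain ⟨⟨m, g⟩, hg, φ, hφ, hle⟩ := hdiv ⟨n, u⟩ ⟨hn, hu⟩
  refine ⟨m, (ht hg).1, Finset.le_sup (f := Sigma.fst) hg, g, (ht hg).2, fun v => ?_, φ, hφ, hle⟩
  exact (Finset.le_sup (Finset.mem_univ v)).trans (Finset.le_sup (f := maxExponent) hg)

variable {r B : ℕ}

theorem exists_mapColumns_eq_of_mem_minGens (hinv : IsInvariantChain i I)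
    (hgen : IsGeneratedUpTo i r B I) {n : ℕ} (hn : i < n) {u : Fin c × Fin n →₀ ℕ}
    (hu : u ∈ minGens (I n)) : ∃ m, i < m ∧ m ≤ r ∧
      ∃ g, MvPolynomial.monomial g (1 : K) ∈ I m ∧ (∀ v, g v ≤ B) ∧
        ∃ φ : Fin m ↪o Fin n, FixesInitial i φ ∧ mapColumns φ g = u := by
  obtain ⟨m, him, hmr, g, hg, hgB, φ, hφ, hle⟩ := hgen n hn u hu.1
  exact ⟨m, him, hmr, g, hg, hgB, φ, hφ,
    hle.antisymm (hu.2 (monomial_mapColumns_mem hinv him hφ hg) hle)⟩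

theorem apply_le_of_mem_minGens (hinv : IsInvariantChain i I) (hgen : IsGeneratedUpTo i r B I)
    {n : ℕ} (hn : i < n) {u : Fin c × Fin n →₀ ℕ} (hu : u ∈ minGens (I n)) (v : Fin c × Fin n) :
    u v ≤ B := by
  obtain ⟨m, -, -, g, -, hgB, φ, -, rfl⟩ := exists_mapColumns_eq_of_mem_minGens hinv hgen hn hu
  exact (mapColumns_le_iff φ (b := Finsupp.equivFunOnFinite.symm fun _ => B)).2
    (fun k j => hgB (k, j)) v

theorem val_succAbove {n : ℕ} (q : Fin (n + 1)) (j : Fin n) :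
    (q.succAbove j : ℕ) = if (j : ℕ) < q then (j : ℕ) else j + 1 := by
  simp only [Fin.succAbove, Fin.lt_def, Fin.val_castSucc, apply_ite Fin.val, Fin.val_succ]

theorem exists_succAbove_mapColumns_eq (hinv : IsInvariantChain i I)
    (hgen : IsGeneratedUpTo i r B I) {s n : ℕ} (his : i ≤ s) (hn : r + s < n)
    {u : Fin c × Fin (n + 1) →₀ ℕ} (hu : u ∈ minGens (I (n + 1))) :
    ∃ q : Fin (n + 1), s ≤ (q : ℕ) ∧
      ∃ u' ∈ minGens (I n), mapColumns q.succAboveOrderEmb u' = u := by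
  obtain ⟨m, him, hmr, g, hg, -, φ, hφ, rfl⟩ :=
    exists_mapColumns_eq_of_mem_minGens hinv hgen (by omega) hu
  obtain ⟨q, hq, hqφ⟩ : ∃ q ∈ Finset.Ici (⟨s, by omega⟩ : Fin (n + 1)),
      q ∉ Finset.univ.map φ.toEmbedding := by
    refine Finset.exists_mem_notMem_of_card_lt_card ?_
    rw [Finset.card_map, Finset.card_fin, Fin.card_Ici, Fin.val_mk]
    omega
  have hsq : s ≤ (q : ℕ) := Fin.le_def.1 (Finset.mem_Ici.1 hq)
  have hψ (j : Fin m) : ∃ j', q.succAbove j' = φ j :=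
    Fin.exists_succAbove_eq fun h => hqφ (by simp [← h])
  choose ψ hψ using hψ
  have hψ_mono : StrictMono ψ := fun a b hab => by
    rw [← (Fin.strictMono_succAbove q).lt_iff_lt, hψ, hψ]
    exact φ.strictMono hab
  let ψ' := OrderEmbedding.ofStrictMono ψ hψ_mono
  have hψ'_fix : FixesInitial i ψ' := fun j hj => by
    have hj' : (q.succAbove (ψ j) : ℕ) = j := by rw [hψ, hφ j hj]
    rw [val_succAbove] at hj'
    change (ψ j : ℕ) = j
    split_ifs at hj' <;> omega
  have hq_fix : FixesInitial i q.succAboveOrderEmb := fun j hj => by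
    rw [Fin.succAboveOrderEmb_apply, val_succAbove, if_pos (by omega)]
  have hcomp : mapColumns q.succAboveOrderEmb (mapColumns ψ' g) = mapColumns φ g := by
    rw [mapColumns_mapColumns]
    congr 1
    exact RelEmbedding.ext hψ
  refine ⟨q, hsq, mapColumns ψ' g,
    ⟨monomial_mapColumns_mem hinv him hψ'_fix hg, fun x hx hle => ?_⟩, hcomp⟩
  rw [← mapColumns_le_mapColumns q.succAboveOrderEmb, hcomp] at hle ⊢
  exact hu.2 (monomial_mapColumns_mem hinv (by omega) hq_fix hx) hle

end Generators

/-! ### Stabilization of the weights -/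

section EventuallyConst

theorem eventuallyConst_of_succ_le {α : Type*} [PartialOrder α] [WellFoundedLT α] {f : ℕ → α}
    (h : ∀ᶠ n in atTop, f (n + 1) ≤ f n) : EventuallyConst f atTop := by
  obtain ⟨N, hN⟩ := eventually_atTop.1 h
  have hanti : Antitone fun k => f (N + k) :=
    antitone_nat_of_succ_le fun k => hN _ (Nat.le_add_right N k)
  obtain ⟨k, hk⟩ := WellFoundedLT.antitone_chain_condition hanti
  refine eventuallyConst_atTop.2 ⟨N + k, fun n hn => ?_⟩
  obtain ⟨d, rfl⟩ := Nat.exists_eq_add_of_le hn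
  rw [add_assoc]
  exact (hk (k + d) (by omega)).symm

theorem eventuallyConst_of_le_succ {f : ℕ → ℕ} {B : ℕ} (hB : ∀ n, f n ≤ B)
    (h : ∀ᶠ n in atTop, f n ≤ f (n + 1)) : EventuallyConst f atTop := by
  have hsub : EventuallyConst (fun n => B - f n) atTop :=
    eventuallyConst_of_succ_le (h.mono fun n hn => Nat.sub_le_sub_left hn B)
  convert hsub.comp (B - ·) using 1
  exact funext fun n => (Nat.sub_sub_self (hB n)).symm

theorem eventuallyConst_of_succ_subset {α : Type*} {A : ℕ → Set α} (hA : ∀ n, (A n).Finite)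
    (h : ∀ᶠ n in atTop, A (n + 1) ⊆ A n) : EventuallyConst A atTop := by
  have hfin : EventuallyConst (fun n => (hA n).toFinset) atTop :=
    eventuallyConst_of_succ_le (h.mono fun n => Set.Finite.toFinset_subset_toFinset.2)
  convert hfin.comp ((↑) : Finset α → Set α) using 1
  exact funext fun n => (hA n).coe_toFinset.symm

theorem eventually_eq_eventualValue {f : ℕ → ℕ} (h : EventuallyConst f atTop) :
    ∀ᶠ n in atTop, f n = eventualValue f := by
  have hex : ∃ a, ∀ᶠ n in atTop, f n = a := eventuallyConst_iff_exists_eventuallyEq.1 h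
  rw [eventualValue, dif_pos hex]
  exact hex.choose_spec

theorem eventualValue_le_eventualValue {f g : ℕ → ℕ} (hf : EventuallyConst f atTop)
    (hg : EventuallyConst g atTop) (h : ∀ᶠ n in atTop, f n ≤ g n) :
    eventualValue f ≤ eventualValue g := by
  obtain ⟨n, hfg, hfn, hgn⟩ :=
    (h.and ((eventually_eq_eventualValue hf).and (eventually_eq_eventualValue hg))).exists
  rwa [hfn, hgn] at hfg

theorem eventually_eventually_eq_eventualValue {f : ℕ → ℕ → ℕ}
    (hf : ∀ s, EventuallyConst (f s) atTop)
    (h : EventuallyConst (fun s => eventualValue (f s)) atTop) :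
    ∀ᶠ s in atTop, ∀ᶠ n in atTop, f s n = eventualValue fun s => eventualValue (f s) := by
  filter_upwards [eventually_eq_eventualValue h] with s hs
  rw [← hs]
  exact eventually_eq_eventualValue (hf s)

end EventuallyConst

section Weights

variable {c m n s t : ℕ}

theorem lt_minIndex_iff {u : Fin c × Fin n →₀ ℕ} :
    s < minIndex u ↔ u ≠ 0 ∧ ∀ k j, u (k, j) ≠ 0 → s ≤ (j : ℕ) := by
  constructor
  · intro h
    have hne : {j | ∃ v ∈ u.support, j = (v.2 : ℕ) + 1}.Nonempty :=
      Nat.nonempty_of_pos_sInf (s.zero_le.trans_lt h)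
    obtain ⟨-, v, hv, -⟩ := hne
    refine ⟨fun h0 => by simp [h0] at hv, fun k j hkj => ?_⟩
    have : minIndex u ≤ (j : ℕ) + 1 := Nat.sInf_le ⟨(k, j), Finsupp.mem_support_iff.2 hkj, rfl⟩
    omega
  · rintro ⟨hu, h⟩
    obtain ⟨v, hv⟩ := Finsupp.support_nonempty_iff.2 hu
    obtain ⟨⟨k, j⟩, hw, he⟩ := Nat.sInf_mem
      (s := {j | ∃ v ∈ u.support, j = (v.2 : ℕ) + 1}) ⟨_, v, hv, rfl⟩
    rw [minIndex, he]
    exact Nat.lt_succ_of_le (h k j (Finsupp.mem_support_iff.1 hw))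

theorem apply_eq_zero_of_lt_minIndex {u : Fin c × Fin n →₀ ℕ} (hu : s < minIndex u) (k : Fin c)
    {j : Fin n} (hj : (j : ℕ) < s) : u (k, j) = 0 := by
  by_contra h
  exact absurd ((lt_minIndex_iff.1 hu).2 k j h) hj.not_ge

theorem monWeightRow_le_iff {k : Fin c} {u : Fin c × Fin n →₀ ℕ} {a : ℕ} :
    monWeightRow s k u ≤ a ↔ ∀ j : Fin n, s ≤ (j : ℕ) → u (k, j) ≤ a := by
  simp [monWeightRow, Finset.sup_le_iff]

theorem monWeight_le_iff {u : Fin c × Fin n →₀ ℕ} {a : ℕ} :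
    monWeight s u ≤ a ↔ ∀ k, ∀ j : Fin n, s ≤ (j : ℕ) → u (k, j) ≤ a := by
  simp [monWeight, Finset.sup_le_iff, monWeightRow_le_iff]

theorem le_monWeightRow (k : Fin c) (u : Fin c × Fin n →₀ ℕ) {j : Fin n} (hj : s ≤ (j : ℕ)) :
    u (k, j) ≤ monWeightRow s k u :=
  monWeightRow_le_iff.1 le_rfl j hj

theorem le_monWeight (k : Fin c) (u : Fin c × Fin n →₀ ℕ) {j : Fin n} (hj : s ≤ (j : ℕ)) :
    u (k, j) ≤ monWeight s u :=
  monWeight_le_iff.1 le_rfl k j hj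

theorem monWeightRow_anti (hst : s ≤ t) (k : Fin c) (u : Fin c × Fin n →₀ ℕ) :
    monWeightRow t k u ≤ monWeightRow s k u :=
  monWeightRow_le_iff.2 fun _ hj => le_monWeightRow k u (hst.trans hj)

theorem monWeight_anti (hst : s ≤ t) (u : Fin c × Fin n →₀ ℕ) : monWeight t u ≤ monWeight s u :=
  Finset.sup_mono_fun fun k _ => monWeightRow_anti hst k u

theorem monWeight_le_of_lt_minIndex {u : Fin c × Fin n →₀ ℕ} (hu : t < minIndex u) :
    monWeight s u ≤ monWeight t u := by
  refine monWeight_le_iff.2 fun k j _ => ?_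
  rcases lt_or_ge (j : ℕ) t with hj | hj
  · exact (apply_eq_zero_of_lt_minIndex hu k hj).trans_le (Nat.zero_le _)
  · exact le_monWeight k u hj

section MapColumns

variable {φ : Fin m ↪o Fin n} (hφ : ∀ j, s ≤ (φ j : ℕ) ↔ s ≤ (j : ℕ))

include hφ

theorem monWeightRow_mapColumns (k : Fin c) (u : Fin c × Fin m →₀ ℕ) :
    monWeightRow s k (mapColumns φ u) = monWeightRow s k u := by
  refine le_antisymm (monWeightRow_le_iff.2 fun j hj => ?_) (monWeightRow_le_iff.2 fun j hj => ?_)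
  · by_cases hjφ : j ∈ Set.range φ
    · obtain ⟨j, rfl⟩ := hjφ
      exact (mapColumns_apply φ u k j).trans_le (le_monWeightRow k u ((hφ j).1 hj))
    · exact (mapColumns_apply_of_notMem_range φ u k hjφ).trans_le (Nat.zero_le _)
  · exact (mapColumns_apply φ u k j).symm.trans_le (le_monWeightRow k _ ((hφ j).2 hj))

theorem monWeight_mapColumns (u : Fin c × Fin m →₀ ℕ) :
    monWeight s (mapColumns φ u) = monWeight s u :=
  Finset.sup_congr rfl fun k _ => monWeightRow_mapColumns hφ k u

theorem lt_minIndex_of_mapColumns {u : Fin c × Fin m →₀ ℕ} (h : s < minIndex (mapColumns φ u)) :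
    s < minIndex u := by
  rw [lt_minIndex_iff] at h ⊢
  refine ⟨?_, fun k j hkj => (hφ j).1 (h.2 k (φ j) (by rwa [mapColumns_apply]))⟩
  rintro rfl
  exact h.1 Finsupp.mapDomain_zero

end MapColumns

theorem le_val_succAbove_iff {q : Fin (n + 1)} (hq : s ≤ (q : ℕ)) (j : Fin n) :
    s ≤ (q.succAbove j : ℕ) ↔ s ≤ (j : ℕ) := by
  rw [val_succAbove]
  split_ifs <;> omega

variable {K : Type*} [Field K]

theorem finite_minGens {σ : Type*} [Finite σ] (J : Ideal (MvPolynomial σ K)) : (minGens J).Finite :=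
  WellQuasiOrderedLE.finite_of_isAntichain (setOfPred_minimal_antichain _)

section Ideal

variable {J : Ideal (R K c n)}

theorem monWeightRow_le_weightRow {u : Fin c × Fin n →₀ ℕ} (hu : u ∈ minGens J) (s : ℕ)
    (k : Fin c) : monWeightRow s k u ≤ weightRow s k J :=
  le_csSup ((finite_minGens J).image _).bddAbove ⟨u, hu, rfl⟩

theorem weightRow_anti (hst : s ≤ t) (k : Fin c) (J : Ideal (R K c n)) :
    weightRow t k J ≤ weightRow s k J := by
  refine csSup_le' ?_
  rintro _ ⟨u, hu, rfl⟩
  exact (monWeightRow_anti hst k u).trans (monWeightRow_le_weightRow hu s k)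

theorem minGensPlus_anti (hst : s ≤ t) (J : Ideal (R K c n)) : minGensPlus t J ⊆ minGensPlus s J :=
  fun _ hu => ⟨hu.1, hst.trans_lt hu.2⟩

theorem monWeight_le_omega (h : minGensPlus s J = ∅) {u : Fin c × Fin n →₀ ℕ}
    (hu : u ∈ minGens J) : monWeight s u ≤ omega s J := by
  rw [omega, if_neg (Set.not_nonempty_iff_eq_empty.2 h)]
  exact le_csSup ((finite_minGens J).image _).bddAbove ⟨u, hu, rfl⟩

theorem omega_le_monWeight {u : Fin c × Fin n →₀ ℕ} (hu : u ∈ minGensPlus s J) :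
    omega s J ≤ monWeight s u := by
  rw [omega, if_pos ⟨u, hu⟩]
  exact Nat.sInf_le ⟨u, hu, rfl⟩

theorem exists_mem_minGensPlus_monWeight_eq_omega (h : (minGensPlus s J).Nonempty) :
    ∃ u ∈ minGensPlus s J, monWeight s u = omega s J := by
  rw [omega, if_pos h]
  exact Nat.sInf_mem (h.image (monWeight s))

theorem omega_le_of_forall_monWeight_le {B : ℕ} (h : ∀ u ∈ minGens J, monWeight s u ≤ B) :
    omega s J ≤ B := by
  by_cases hplus : (minGensPlus s J).Nonempty
  · obtain ⟨u, hu⟩ := hplus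
    exact (omega_le_monWeight hu).trans (h u hu.1)
  · rw [omega, if_neg hplus]
    exact csSup_le' (Set.forall_mem_image.2 h)

theorem omega_mono (hst : s ≤ t) (h : (minGensPlus t J).Nonempty) : omega s J ≤ omega t J := by
  obtain ⟨u, hu, hω⟩ := exists_mem_minGensPlus_monWeight_eq_omega h
  rw [← hω]
  exact (omega_le_monWeight (minGensPlus_anti hst J hu)).trans (monWeight_le_of_lt_minIndex hu.2)

theorem omega_anti (hst : s ≤ t) (h : minGensPlus s J = ∅) : omega t J ≤ omega s J :=
  omega_le_of_forall_monWeight_le fun u hu => (monWeight_anti hst u).trans (monWeight_le_omega h hu)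

theorem exists_mem_minGens_monWeight_le_omega {b : Fin c × Fin n →₀ ℕ}
    (hb : MvPolynomial.monomial b (1 : K) ∈ J) (s : ℕ) : ∃ u ∈ minGens J,
      monWeight s u ≤ omega s J ∧ ∀ k (j : Fin n), (j : ℕ) < s → u (k, j) ≤ b (k, j) := by
  rcases (minGensPlus s J).eq_empty_or_nonempty with h | h
  · obtain ⟨u, hu, hub⟩ := exists_mem_minGens_le hb
    exact ⟨u, hu, monWeight_le_omega h hu, fun k j _ => hub (k, j)⟩
  · obtain ⟨u, hu, hω⟩ := exists_mem_minGensPlus_monWeight_eq_omega h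
    exact ⟨u, hu.1, hω.le, fun k j hj =>
      (apply_eq_zero_of_lt_minIndex hu.2 k hj).trans_le (Nat.zero_le _)⟩

end Ideal

section Chain

variable {i r B : ℕ} {I : ∀ n, Ideal (R K c n)} (hinv : IsInvariantChain i I)
  (hgen : IsGeneratedUpTo i r B I)

include hinv hgen

theorem exists_mem_minGens_weights_eq (hn : r + (i + s) < n) {u : Fin c × Fin (n + 1) →₀ ℕ}
    (hu : u ∈ minGens (I (n + 1))) : ∃ u' ∈ minGens (I n),
      (∀ k, monWeightRow s k u' = monWeightRow s k u) ∧ monWeight s u' = monWeight s u ∧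
        (s < minIndex u → s < minIndex u') := by
  obtain ⟨q, hq, u', hu', rfl⟩ :=
    exists_succAbove_mapColumns_eq hinv hgen (Nat.le_add_right i s) hn hu
  have hφ (j : Fin n) : s ≤ (q.succAboveOrderEmb j : ℕ) ↔ s ≤ (j : ℕ) :=
    le_val_succAbove_iff (by omega) j
  exact ⟨u', hu', fun k => (monWeightRow_mapColumns hφ k u').symm,
    (monWeight_mapColumns hφ u').symm, lt_minIndex_of_mapColumns hφ⟩

theorem eventuallyConst_weightRow (s : ℕ) (k : Fin c) :
    EventuallyConst (fun n => weightRow s k (I n)) atTop := by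
  refine (eventuallyConst_of_succ_subset (fun n => (finite_minGens (I n)).image _) ?_).comp sSup
  filter_upwards [eventually_gt_atTop (r + (i + s))] with n hn
  rintro _ ⟨u, hu, rfl⟩
  obtain ⟨u', hu', h, -⟩ := exists_mem_minGens_weights_eq hinv hgen hn hu
  exact ⟨u', hu', h k⟩

theorem eventuallyConst_monWeight_image_minGens (s : ℕ) :
    EventuallyConst (fun n => monWeight s '' minGens (I n)) atTop := by
  refine eventuallyConst_of_succ_subset (fun n => (finite_minGens (I n)).image _) ?_
  filter_upwards [eventually_gt_atTop (r + (i + s))] with n hn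
  rintro _ ⟨u, hu, rfl⟩
  obtain ⟨u', hu', -, h, -⟩ := exists_mem_minGens_weights_eq hinv hgen hn hu
  exact ⟨u', hu', h⟩

theorem eventuallyConst_monWeight_image_minGensPlus (s : ℕ) :
    EventuallyConst (fun n => monWeight s '' minGensPlus s (I n)) atTop := by
  refine eventuallyConst_of_succ_subset
    (fun n => ((finite_minGens (I n)).subset (Set.sep_subset _ _)).image _) ?_
  filter_upwards [eventually_gt_atTop (r + (i + s))] with n hn
  rintro _ ⟨u, hu, rfl⟩
  obtain ⟨u', hu', -, h, h'⟩ := exists_mem_minGens_weights_eq hinv hgen hn hu.1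
  exact ⟨u', ⟨hu', h' hu.2⟩, h⟩

theorem eventuallyConst_omega (s : ℕ) : EventuallyConst (fun n => omega s (I n)) atTop := by
  classical
  convert (eventuallyConst_monWeight_image_minGensPlus hinv hgen s).comp₂
    (fun S T => if S.Nonempty then sInf S else sSup T)
    (eventuallyConst_monWeight_image_minGens hinv hgen s) using 2 with n
  simp only [omega, Set.image_nonempty]

theorem eventually_minGensPlus_nonempty_or_eventually_eq_empty (s : ℕ) :
    (∀ᶠ n in atTop, (minGensPlus s (I n)).Nonempty) ∨ ∀ᶠ n in atTop, minGensPlus s (I n) = ∅ := by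
  have h := (eventuallyConst_monWeight_image_minGensPlus hinv hgen s).comp Set.Nonempty
  simpa only [eventuallyConst_pred, Function.comp_apply, Set.image_nonempty,
    Set.not_nonempty_iff_eq_empty] using h

theorem eventually_weightRow_eq_chainWeightRow (k : Fin c) :
    ∀ᶠ s in atTop, ∀ᶠ n in atTop, weightRow s k (I n) = chainWeightRow k I := by
  have hconst (s : ℕ) := eventuallyConst_weightRow hinv hgen s k
  refine eventually_eventually_eq_eventualValue hconst (eventuallyConst_of_succ_le ?_)
  exact Eventually.of_forall fun s => eventualValue_le_eventualValue (hconst _) (hconst _) <|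
    Eventually.of_forall fun n => weightRow_anti s.le_succ k (I n)

theorem omega_le_of_isGeneratedUpTo (hn : i < n) (s : ℕ) : omega s (I n) ≤ B :=
  omega_le_of_forall_monWeight_le fun _ hu =>
    monWeight_le_iff.2 fun k j _ => apply_le_of_mem_minGens hinv hgen hn hu (k, j)

theorem eventually_omega_eq_chainOmega :
    ∀ᶠ s in atTop, ∀ᶠ n in atTop, omega s (I n) = chainOmega I := by
  have hconst (s : ℕ) := eventuallyConst_omega hinv hgen s
  refine eventually_eventually_eq_eventualValue hconst ?_
  by_cases hplus : ∀ s, ∀ᶠ n in atTop, (minGensPlus s (I n)).Nonempty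
  · refine eventuallyConst_of_le_succ (B := B) (fun s => ?_) (Eventually.of_forall fun s => ?_)
    · obtain ⟨n, hn, hin⟩ :=
        ((eventually_eq_eventualValue (hconst s)).and (eventually_gt_atTop i)).exists
      exact hn.symm.trans_le (omega_le_of_isGeneratedUpTo hinv hgen hin s)
    · exact eventualValue_le_eventualValue (hconst _) (hconst _)
        ((hplus (s + 1)).mono fun n => omega_mono s.le_succ)
  · obtain ⟨s₀, hs₀⟩ := not_forall.1 hplus
    have hempty : ∀ᶠ n in atTop, minGensPlus s₀ (I n) = ∅ :=
      (eventually_minGensPlus_nonempty_or_eventually_eq_empty hinv hgen s₀).resolve_left hs₀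
    refine eventuallyConst_of_succ_le ?_
    filter_upwards [eventually_ge_atTop s₀] with s hs
    refine eventualValue_le_eventualValue (hconst _) (hconst _) ?_
    filter_upwards [hempty] with n hn
    exact omega_anti s.le_succ (Set.subset_eq_empty (minGensPlus_anti hs _) hn)

end Chain

end Weights

/-! ### The linear bound -/

section LargeColumns

theorem lt_card_filter_of_lt_sum {ι : Type*} [Fintype ι] {d : ι → ℕ} {C E N : ℕ}
    (hE : ∀ j, d j ≤ E) (h : C * Fintype.card ι + N * E < ∑ j, d j) :
    N < (Finset.univ.filter (C < d ·)).card := by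
  by_contra! hN
  refine h.not_ge ?_
  calc ∑ j, d j ≤ ∑ j, (C + if C < d j then E else 0) := Finset.sum_le_sum fun j _ => by
        split_ifs with hj
        · exact (hE j).trans (Nat.le_add_left _ _)
        · exact not_lt.1 hj
    _ = C * Fintype.card ι + (Finset.univ.filter (C < d ·)).card * E := by
        rw [Finset.sum_add_distrib, ← Finset.sum_filter, Finset.sum_const, Finset.sum_const,
          Finset.card_univ, smul_eq_mul, smul_eq_mul, mul_comm C]
    _ ≤ C * Fintype.card ι + N * E := by gcongr

variable {c n r s B ω : ℕ}

theorem lt_card_columns_of_lt_degree {b : Fin c × Fin n →₀ ℕ} {C : ℕ} (hB : ∀ v, b v ≤ B)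
    (h : C * n + (s + r) * (c * B) < b.degree) :
    r < (Finset.univ.filter fun j : Fin n => s ≤ (j : ℕ) ∧ C < ∑ k, b (k, j)).card := by
  have hcol (j : Fin n) : ∑ k, b (k, j) ≤ c * B :=
    (Finset.sum_le_card_nsmul _ _ B fun k _ => hB (k, j)).trans_eq (by simp)
  have hlarge := lt_card_filter_of_lt_sum hcol (C := C) (N := s + r) <| by
    rwa [Fintype.card_fin, ← Fintype.sum_prod_type_right, ← Finsupp.degree_eq_sum]
  have hfirst : (Finset.univ.filter fun j : Fin n => (j : ℕ) < s).card ≤ s :=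
    (Finset.card_le_card_of_injOn Fin.val (t := Finset.range s) (by simp [Set.MapsTo])
      Fin.val_injective.injOn).trans_eq (Finset.card_range s)
  have hunion : Finset.univ.filter (fun j : Fin n => C < ∑ k, b (k, j)) ⊆
      (Finset.univ.filter fun j : Fin n => (j : ℕ) < s) ∪
        Finset.univ.filter fun j : Fin n => s ≤ (j : ℕ) ∧ C < ∑ k, b (k, j) := fun j hj => by
    simp [lt_or_ge, (Finset.mem_filter.1 hj).2]
  have := (Finset.card_le_card hunion).trans (Finset.card_union_le _ _)
  omega

theorem exists_apply_ne_zero_of_lt_degree {b : Fin c × Fin n →₀ ℕ} (hB : ∀ v, b v ≤ B)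
    (h : s * (c * B) < b.degree) : ∃ k, ∃ j : Fin n, s ≤ (j : ℕ) ∧ b (k, j) ≠ 0 := by
  obtain ⟨j, hj⟩ := Finset.card_pos.1 <|
    lt_card_columns_of_lt_degree (C := 0) (r := 0) (s := s) hB (by simpa using h)
  obtain ⟨hsj, hpos⟩ := (Finset.mem_filter.1 hj).2
  obtain ⟨k, -, hk⟩ := Finset.exists_ne_zero_of_sum_ne_zero hpos.ne'
  exact ⟨k, j, hsj, hk⟩

/-- The largest possible degree of a column with `k`-th entry at most `w k` in which some entry is
smaller than `ω` (for `ω = 0`, when there is no such column, `ω - 1` is truncated to `0`). -/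
def columnDegreeBound (ω : ℕ) (w : Fin c → ℕ) : ℕ :=
  ω - 1 + Finset.univ.sup fun l : Fin c => ∑ k ∈ Finset.univ.erase l, w k

theorem le_of_columnDegreeBound_lt_sum {x w : Fin c → ℕ} (hx : ∀ k, x k ≤ w k)
    (h : columnDegreeBound ω w < ∑ k, x k) (l : Fin c) : ω ≤ x l := by
  by_contra! hl
  refine h.not_ge ?_
  rw [← Finset.add_sum_erase _ _ (Finset.mem_univ l)]
  refine add_le_add (Nat.le_sub_one_of_lt hl) ((Finset.sum_le_sum fun k _ => hx k).trans ?_)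
  exact Finset.le_sup (f := fun l : Fin c => ∑ k ∈ Finset.univ.erase l, w k) (Finset.mem_univ l)

theorem boundCoeff_eq_columnDegreeBound {K : Type*} [Field K] (I : ∀ n, Ideal (R K c n)) :
    boundCoeff I = (columnDegreeBound (chainOmega I) fun k => chainWeightRow k I : ℕ) := by
  rw [boundCoeff, columnDegreeBound, Nat.cast_add]
  congr 1
  omega

theorem exists_orderEmbedding_mem_of_le {m : ℕ} (φ : Fin m ↪o Fin n) {T : Finset (Fin n)}
    (hm : m ≤ T.card) (hT : ∀ j ∈ T, s ≤ (j : ℕ)) : ∃ ψ : Fin m ↪o Fin n,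
      ∀ j, ((φ j : ℕ) < s → ψ j = φ j) ∧ (s ≤ (φ j : ℕ) → ψ j ∈ T) := by
  let ψ (j : Fin m) : Fin n := if (φ j : ℕ) < s then φ j else T.orderEmbOfCardLe hm j
  have hψ_lt {j} (h : (φ j : ℕ) < s) : ψ j = φ j := if_pos h
  have hψ_ge {j} (h : s ≤ (φ j : ℕ)) : ψ j = T.orderEmbOfCardLe hm j := if_neg h.not_gt
  have hψ_mem {j} (h : s ≤ (φ j : ℕ)) : ψ j ∈ T :=
    hψ_ge h ▸ Finset.orderEmbOfCardLe_mem _ _ _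
  have hmono : StrictMono ψ := fun a a' h => by
    have hφ : (φ a : ℕ) < φ a' := φ.strictMono h
    rcases lt_or_ge (φ a' : ℕ) s with ha' | ha'
    · rw [hψ_lt ha', hψ_lt (hφ.trans ha')]
      exact hφ
    · rcases lt_or_ge (φ a : ℕ) s with ha | ha
      · rw [hψ_lt ha]
        exact Fin.lt_def.2 (ha.trans_le (hT _ (hψ_mem ha')))
      · rw [hψ_ge ha, hψ_ge ha']
        exact (T.orderEmbOfCardLe hm).strictMono h
  exact ⟨OrderEmbedding.ofStrictMono ψ hmono, fun j => ⟨hψ_lt, hψ_mem⟩⟩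

end LargeColumns

section Bound

variable {K : Type*} [Field K]

theorem isConePoint_of_forall_mem_minGens_lt {σ : Type*} {J : Ideal (MvPolynomial σ K)}
    {a : σ →₀ ℕ} {v : σ} (hv : ∀ u ∈ minGens J, u v < a v) (ha : a v ≠ 0) (p : ℕ) :
    IsConePoint J p a v := by
  refine ⟨ha, fun ρ b _ hvρ hab hb => ?_⟩
  obtain ⟨u, hu, hub⟩ := exists_mem_minGens_le hb
  refine monomial_mem_of_le hu.1 fun x => ?_
  by_cases hx : x = v
  · subst hx
    have hlt := hv u hu
    rw [← hab, Finsupp.add_apply, Finsupp.add_apply, squarefreeExponent_apply_of_notMem hvρ,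
      Finsupp.single_eq_same] at hlt
    omega
  · simpa [Finsupp.single_eq_of_ne hx] using hub x

variable {c i r B : ℕ} {I : ∀ n, Ideal (R K c n)} (hinv : IsInvariantChain i I)
  (hgen : IsGeneratedUpTo i r B I)

include hinv hgen

theorem monomial_mem_of_monWeight_le {s n : ℕ} (his : i ≤ s) (hn : i < n)
    {u b : Fin c × Fin n →₀ ℕ} (hu : MvPolynomial.monomial u (1 : K) ∈ I n)
    (hub : ∀ k (j : Fin n), (j : ℕ) < s → u (k, j) ≤ b (k, j)) {T : Finset (Fin n)}
    (hT : ∀ j ∈ T, s ≤ (j : ℕ) ∧ ∀ k, monWeight s u ≤ b (k, j)) (hcard : r ≤ T.card) :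
    MvPolynomial.monomial b (1 : K) ∈ I n := by
  obtain ⟨m, him, hmr, g, hg, -, φ, hφ, hle⟩ := hgen n hn u hu
  rw [mapColumns_le_iff] at hle
  obtain ⟨ψ, hψ⟩ := exists_orderEmbedding_mem_of_le φ (hmr.trans hcard) fun j hj => (hT j hj).1
  have hψ_fix : FixesInitial i ψ := fun j hj => by
    rw [(hψ j).1 (by rw [hφ j hj]; omega), hφ j hj]
  refine monomial_mem_of_le (monomial_mapColumns_mem hinv him hψ_fix hg) <|
    (mapColumns_le_iff ψ).2 fun k j => (hle k j).trans ?_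
  rcases lt_or_ge (φ j : ℕ) s with hj | hj
  · rw [(hψ j).1 hj]
    exact hub k _ hj
  · exact (le_monWeight k u hj).trans ((hT _ ((hψ j).2 hj)).2 k)

variable {s n : ℕ} (his : i ≤ s) (hn : i < n)

include his hn

theorem isConePoint_of_lt_degree {p : ℕ} {a : Fin c × Fin n →₀ ℕ} (haB : ∀ v, a v ≤ B)
    (haw : ∀ k (j : Fin n), s ≤ (j : ℕ) → a (k, j) ≤ weightRow s k (I n))
    (hdeg : columnDegreeBound (omega s (I n)) (fun k => weightRow s k (I n)) * n +
      (s + r) * (c * B) + 1 + p < a.degree)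
    {k : Fin c} {j : Fin n} (hj : s ≤ (j : ℕ)) (hkj : a (k, j) ≠ 0) :
    IsConePoint (I n) p a (k, j) := by
  refine ⟨hkj, fun ρ b hρ _ hab hb => ?_⟩
  have hba : b ≤ a := by
    rw [← hab, add_assoc]
    exact le_self_add
  have hdeg_b : b.degree + 1 + p = a.degree := by
    rw [← hab, map_add, map_add, degree_squarefreeExponent, hρ, Finsupp.degree_single]
  have hcard := lt_card_columns_of_lt_degree (s := s) (r := r)
    (C := columnDegreeBound (omega s (I n)) fun k => weightRow s k (I n))
    (fun v => (hba v).trans (haB v)) (by omega)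
  obtain ⟨u, hu, huω, hub⟩ := exists_mem_minGens_monWeight_le_omega hb s
  refine monomial_mem_of_monWeight_le hinv hgen his hn hu.1 (fun k' j' hj' => ?_)
    (fun j' hj' => ?_) hcard.le
  · have hne : (k', j') ≠ (k, j) := by
      rintro ⟨⟩
      exact hj'.not_ge hj
    simpa [Finsupp.single_eq_of_ne hne] using hub k' j' hj'
  · obtain ⟨hsj', hlarge⟩ := (Finset.mem_filter.1 hj').2
    exact ⟨hsj', fun k' => huω.trans <|
      le_of_columnDegreeBound_lt_sum (fun k => (hba _).trans (haw k j' hsj')) hlarge k'⟩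

theorem exists_isConePoint {p : ℕ} {a : Fin c × Fin n →₀ ℕ}
    (hdeg : columnDegreeBound (omega s (I n)) (fun k => weightRow s k (I n)) * n +
      (s + r) * (c * B) + 1 + p < a.degree) : ∃ v, IsConePoint (I n) p a v := by
  by_cases haB : ∃ v, B < a v
  · obtain ⟨v, hv⟩ := haB
    exact ⟨v, isConePoint_of_forall_mem_minGens_lt
      (fun u hu => (apply_le_of_mem_minGens hinv hgen hn hu v).trans_lt hv) (by omega) p⟩
  by_cases haw : ∃ k, ∃ j : Fin n, s ≤ (j : ℕ) ∧ weightRow s k (I n) < a (k, j)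
  · obtain ⟨k, j, hj, hkj⟩ := haw
    exact ⟨(k, j), isConePoint_of_forall_mem_minGens_lt (fun u hu =>
      ((le_monWeightRow k u hj).trans (monWeightRow_le_weightRow hu s k)).trans_lt hkj)
      (by omega) p⟩
  push Not at haB haw
  obtain ⟨k, j, hj, hkj⟩ := exists_apply_ne_zero_of_lt_degree (s := s) haB <| by
    rw [add_mul] at hdeg
    omega
  exact ⟨(k, j), isConePoint_of_lt_degree hinv hgen his hn haB haw hdeg hj hkj⟩

theorem reg_le_of_isGeneratedUpTo (hmon : IsMonomialIdeal (I n)) :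
    reg (I n) ≤ (((columnDegreeBound (omega s (I n)) (fun k => weightRow s k (I n)) * n +
      ((s + r) * (c * B) + 1) : ℤ) : ℝ) : EReal) := by
  have h := reg_le_of_exists_isConePoint hmon fun p a ha =>
    exists_isConePoint hinv hgen his hn (p := p) (a := a) ha
  rw [add_assoc] at h
  exact_mod_cast h

end Bound

end IncChain

end

theorem mainTheorem1 {K : Type*} [Field K] (c : ℕ) (hc : 1 ≤ c) (i : ℕ)
    (I : ∀ n : ℕ, Ideal (IncChain.R K c n))
    (hmon : ∀ n, 1 ≤ n → IncChain.IsMonomialIdeal (I n))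
    (hinv : IncChain.IsInvariantChain i I)
    (hne : ∃ n, 1 ≤ n ∧ I n ≠ ⊥) :
    -- the stabilized weights are well defined
    (∀ k : Fin c, ∀ᶠ i' in Filter.atTop, ∀ᶠ n in Filter.atTop,
      IncChain.weightRow i' k (I n) = IncChain.chainWeightRow k I) ∧
    (∀ᶠ i' in Filter.atTop, ∀ᶠ n in Filter.atTop,
      IncChain.omega i' (I n) = IncChain.chainOmega I) ∧
    -- the linear bound
    ∃ D : ℤ, ∀ᶠ n : ℕ in Filter.atTop,
      IncChain.reg (I n) ≤ (((IncChain.boundCoeff I * (n : ℤ) + D : ℤ) : ℝ) : EReal) := by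
  obtain ⟨r, B, hgen⟩ := IncChain.exists_isGeneratedUpTo i I
  have hw := IncChain.eventually_weightRow_eq_chainWeightRow hinv hgen
  have hω := IncChain.eventually_omega_eq_chainOmega hinv hgen
  refine ⟨hw, hω, ?_⟩
  obtain ⟨s, hws, hωs, his⟩ :=
    ((Filter.eventually_all.2 hw).and (hω.and (Filter.eventually_ge_atTop i))).exists
  refine ⟨(s + r) * (c * B) + 1, ?_⟩
  filter_upwards [Filter.eventually_all.2 hws, hωs, Filter.eventually_gt_atTop i] with n hwn hωn hn
  have hreg := IncChain.reg_le_of_isGeneratedUpTo hinv hgen his hn (hmon n (by omega))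
  simpa only [IncChain.boundCoeff_eq_columnDegreeBound, hwn, hωn] using hreg
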